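/- Let $\pi\in(0,1)$, $\epsilon>0$, $B>0$, and let $\mathcal L$ be the set of probability measures $\eta$ on $\mathbb R$ with $\int|y|^{1+\epsilon}\,d\eta(y)\le B$. For a probability measure $\eta$ on $\mathbb R$ with distribution function $F_\eta$, let $x_\pi(\eta)=\min\{z\in\mathbb R: F_\eta(z)\ge\pi\}$ (value-at-risk) and $$c_\pi(\eta)=\frac{F_\eta(x_\pi(\eta))-\pi}{1-\pi}\,x_\pi(\eta)+\frac1{1-\pi}\int_{(x_\pi(\eta),\infty)}y\,dF_\eta(y)$$ (conditional value-at-risk), and for $v\in\mathbb R$ put $$\mathrm{KL}^U_{\inf}(\eta,v)=\inf\{\mathrm{KL}(\eta,\kappa):\kappa\in\mathcal L,\ c_\pi(\kappa)\ge v\},\qquad \mathrm{KL}^L_{\inf}(\eta,v)=\inf\{\mathrm{KL}(\eta,\kappa):\kappa\in\mathcal L,\ c_\pi(\kappa)\le v\},$$ with values in $[0,\infty]$, where $\mathrm{KL}$ is the Kullback--Leibler divergence. Let $\mu_1,\dots,\mu_K\in\mathcal L$ be the distributions of $K$ arms. The arms are sampled sequentially by an arbitrary non-anticipating (possibly randomized)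 rule: in each round an arm is chosen on the basis of the past, and, given the past and the choice, the observed sample is distributed according to the distribution of the chosen arm. Let $N_a(n)$ be the number of samples from arm $a$ among the first $n$ samples, and $\hat\mu_a(n)$ the empirical distribution of these $N_a(n)$ samples (a term with $N_a(n)=0$ is read as $0$). Let $h(n)=5\log(n+1)+2$. Then for all arms $i\ne j$ and all $x\ge0$, $$\mathbb P\Bigl(\exists n\in\mathbb N:\ N_i(n)\,\mathrm{KL}^U_{\inf}(\hat\mu_i(n),c_\pi(\mu_i))+N_j(n)\,\mathrm{KL}^L_{\inf}(\hat\mu_j(n),c_\pi(\mu_j))-h(n)\ge x\Bigr)\le e^{-x}.$$ -/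

import Mathlib

open MeasureTheory ProbabilityTheory InformationTheory Set
open scoped ENNReal

noncomputable section

/-- The class of probability measures `η` on `ℝ` with `∫ |y|^(1+ε) dη(y) ≤ B`. -/
def momentClass (ε B : ℝ) : Set (Measure ℝ) :=
  {η | IsProbabilityMeasure η ∧ ∫⁻ y, ENNReal.ofReal (|y| ^ (1 + ε)) ∂η ≤ ENNReal.ofReal B}

/-- Value-at-risk of `η` at level `π`: the smallest `z` with `π ≤ η((-∞, z])`
(the infimum is attained when `η` is a probability measure and `0 < π < 1`). -/
def valueAtRisk (π : ℝ) (η : Measure ℝ) : ℝ :=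
  sInf {z : ℝ | π ≤ η.real (Iic z)}

/-- Conditional value-at-risk of `η` at level `π`. The mass of a possible atom at the value-at-risk
is accounted for by the first summand, hence the integral is over the open half-line. -/
def condValueAtRisk (π : ℝ) (η : Measure ℝ) : ℝ :=
  (η.real (Iic (valueAtRisk π η)) - π) / (1 - π) * valueAtRisk π η
    + 1 / (1 - π) * ∫ y in Ioi (valueAtRisk π η), y ∂η

/-- The least Kullback-Leibler divergence from `η` to a member of the moment class whose conditional
value-at-risk is at least `x`. -/
def klInfU (π ε B : ℝ) (η : Measure ℝ) (x : ℝ) : ℝ≥0∞ :=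
  ⨅ κ ∈ {κ : Measure ℝ | κ ∈ momentClass ε B ∧ x ≤ condValueAtRisk π κ}, klDiv η κ

/-- The least Kullback-Leibler divergence from `η` to a member of the moment class whose conditional
value-at-risk is at most `x`. -/
def klInfL (π ε B : ℝ) (η : Measure ℝ) (x : ℝ) : ℝ≥0∞ :=
  ⨅ κ ∈ {κ : Measure ℝ | κ ∈ momentClass ε B ∧ condValueAtRisk π κ ≤ x}, klDiv η κ

/-- Sequential sampling from `K` arms with distributions `μ a`. Rounds are numbered from `0`; in
round `t` the arm `A t` is pulled and the sample `X t` is observed. The σ-algebra `ℱ t` holds what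
is known when the sample of round `t` is about to be drawn (the past, the chosen arm, and any
additional randomization), and given `ℱ t` the sample has the distribution of the chosen arm. -/
structure IsBanditProcess {Ω : Type*} {mΩ : MeasurableSpace Ω} {K : ℕ} (μ : Fin K → Measure ℝ)
    (P : Measure Ω) (ℱ : Filtration ℕ mΩ) (A : ℕ → Ω → Fin K) (X : ℕ → Ω → ℝ) : Prop where
  /-- the choice of the arm is non-anticipating -/
  measurable_arm : ∀ t, Measurable[ℱ t] (A t)
  /-- the sample of round `t` is known from round `t + 1` on -/
  measurable_sample : ∀ t, Measurable[ℱ (t + 1)] (X t)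
  /-- given `ℱ t`, the sample of round `t` is drawn from the distribution of the chosen arm -/
  condDistrib_sample : ∀ t, ∀ s : Set ℝ, MeasurableSet s →
    P⟦X t ⁻¹' s | ℱ t⟧ =ᵐ[P] fun ω => (μ (A t ω)).real s

section Empirical

variable {Ω : Type*} {K : ℕ}

/-- The rounds among the first `n` in which arm `a` was pulled. -/
def pullTimes (A : ℕ → Ω → Fin K) (a : Fin K) (n : ℕ) (ω : Ω) : Finset ℕ :=
  (Finset.range n).filter fun t => A t ω = a

/-- `N_a(n)`: the number of samples from arm `a` among the first `n` samples. -/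
def pullCount (A : ℕ → Ω → Fin K) (a : Fin K) (n : ℕ) (ω : Ω) : ℕ :=
  (pullTimes A a n ω).card

/-- The empirical distribution of the samples from arm `a` among the first `n` samples
(the zero measure if there is none). -/
def empiricalMeasure (A : ℕ → Ω → Fin K) (X : ℕ → Ω → ℝ) (a : Fin K) (n : ℕ) (ω : Ω) :
    Measure ℝ :=
  (pullCount A a n ω : ℝ≥0∞)⁻¹ • ∑ t ∈ pullTimes A a n ω, Measure.dirac (X t ω)

end Empirical

end

/-! Convex duality turns each `KL_inf` into the logarithm of an e-value. If `D` lies below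
`KL_inf(η, v)` for a discrete `η`, then some parameter `λ` of a convex set satisfies `∫ log g(y, λ)
dη(y) > D`, where `g ≥ 0` is concave in `λ` and `∫ g(y, λ) dμ(y) ≤ 1` for the true distribution `μ`
of the arm. Hence `exp (N KL_inf)` is, up to slack, at most a product of e-values along the samples,
evaluated at a parameter chosen in hindsight (`exists_upperDualFn_lt`, `exists_lowerDualFn_lt`, both
from the abstract `exists_dual_certificate`).

The two constraints are treated differently because conditional value-at-risk is concave in the
distribution. The set where it is at least `v` is convex, and is described linearly by splitting a
measure into a lower part of mass `π` and a tail of mass `1 - π`; this costs three multipliers. The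
set where it is at most `v` is not convex, but `(1 - π)(CVaR - z) ≤ E (Y - z)⁺` for every `z`.
Fixing `z` at the value-at-risk of the true arm shrinks the feasible set to a convex one, which only
raises the infimum, and keeps the true arm feasible because equality holds there; this costs two
multipliers.

The hindsight parameter is handled by a uniform mixture over the joint parameter set, of dimension
`3 + 2 = 5`. Shrinking this set towards the chosen parameter by the factor `1/(n+1)` shows that the
mixture loses at most a factor `e (n+1)^5` (`prod_mul_measure_le_mixture`). The mixture is a
nonnegative supermartingale under any sampling rule, so Ville's inequality applies. In `h(n)`, the
term `5 log (n+1)` and one unit pay for the mixture; the other unit pays for the strict inequality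
`D < KL_inf`, half for each arm. -/

/-! ### Conic duality for weighted geometric means -/

section Duality

open scoped Pointwise

variable {ι σ : Type*} [Fintype ι] [Fintype σ]

/-- Nonnegative weights whose row sums have weighted geometric mean at least `exp r`. -/
def geomMeanSet (σ : Type*) [Fintype σ] (w : ι → ℝ) (r : ℝ) : Set (ι → σ → ℝ) :=
  {p | (∀ i s, 0 ≤ p i s) ∧ (∀ i, 0 < ∑ s, p i s) ∧ r ≤ ∑ i, w i * Real.log (∑ s, p i s)}

/-- Exponentiating replaces the logarithmic and the strict conditions by one inequality between
continuous functions: as every `w i` is positive, a vanishing row sum makes the product zero, hence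
smaller than `exp r`. -/
theorem isClosed_geomMeanSet {w : ι → ℝ} (hw : ∀ i, 0 < w i) (r : ℝ) :
    IsClosed (geomMeanSet σ w r) := by
  have key : geomMeanSet σ w r = {p : ι → σ → ℝ | ∀ i s, 0 ≤ p i s} ∩
      {p | Real.exp r ≤ ∏ i, (∑ s, p i s) ^ w i} := by
    ext p
    simp only [geomMeanSet, mem_ofPred_eq, mem_inter_iff]
    refine and_congr_right fun h0 => ?_
    have hs : ∀ i, 0 ≤ ∑ s, p i s := fun i => Finset.sum_nonneg fun s _ => h0 i s
    have hexp : (∀ i, 0 < ∑ s, p i s) →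
        ∏ i, (∑ s, p i s) ^ w i = Real.exp (∑ i, w i * Real.log (∑ s, p i s)) := by
      intro h
      rw [Real.exp_sum]
      exact Finset.prod_congr rfl fun i _ => by rw [Real.rpow_def_of_pos (h i), mul_comm]
    constructor
    · rintro ⟨h1, h2⟩
      rw [hexp h1]
      exact Real.exp_le_exp.2 h2
    · intro h
      have h1 : ∀ i, 0 < ∑ s, p i s := by
        intro i
        refine (hs i).lt_of_ne fun hi => ?_
        have : ∏ i, (∑ s, p i s) ^ w i = 0 :=
          Finset.prod_eq_zero (Finset.mem_univ i) (by rw [← hi, Real.zero_rpow (hw i).ne'])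
        exact absurd (Real.exp_pos r) (not_lt.2 (this ▸ h))
      exact ⟨h1, Real.exp_le_exp.1 (hexp h1 ▸ h)⟩
  rw [key]
  refine IsClosed.inter ?_ ?_
  · simp only [ofPred_forall]
    exact isClosed_iInter fun i => isClosed_iInter fun s =>
      isClosed_le continuous_const (by fun_prop)
  · refine isClosed_le continuous_const (continuous_finsetProd _ fun i _ => ?_)
    exact (Real.continuous_rpow_const (hw i).le).comp (by fun_prop)

theorem convex_geomMeanSet {w : ι → ℝ} (hw : ∀ i, 0 < w i) (r : ℝ) :
    Convex ℝ (geomMeanSet σ w r) := by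
  rintro p ⟨hp0, hp1, hp2⟩ q ⟨hq0, hq1, hq2⟩ a b ha hb hab
  have hsum : ∀ i, ∑ s, (a • p + b • q) i s = a * ∑ s, p i s + b * ∑ s, q i s := by
    intro i
    simp [Finset.sum_add_distrib, Finset.mul_sum]
  refine ⟨fun i s => ?_, fun i => ?_, ?_⟩
  · have := mul_nonneg ha (hp0 i s)
    have := mul_nonneg hb (hq0 i s)
    simp only [Pi.add_apply, Pi.smul_apply, smul_eq_mul]
    positivity
  · rw [hsum]
    exact (convex_Ioi (0 : ℝ)) (hp1 i) (hq1 i) ha hb hab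
  · calc r = a * r + b * r := by rw [← add_mul, hab, one_mul]
      _ ≤ a * ∑ i, w i * Real.log (∑ s, p i s) + b * ∑ i, w i * Real.log (∑ s, q i s) := by
        gcongr
      _ = ∑ i, w i * (a * Real.log (∑ s, p i s) + b * Real.log (∑ s, q i s)) := by
        rw [Finset.mul_sum, Finset.mul_sum, ← Finset.sum_add_distrib]
        exact Finset.sum_congr rfl fun i _ => by ring
      _ ≤ _ := by
        refine Finset.sum_le_sum fun i _ => mul_le_mul_of_nonneg_left ?_ (hw i).le
        rw [hsum]
        exact strictConcaveOn_log_Ioi.concaveOn.2 (hp1 i) (hq1 i) ha hb hab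

variable {E : Type*} [NormedAddCommGroup E] [NormedSpace ℝ E]

/-- Strong duality for the maximization of a weighted geometric mean under conic constraints,
in the form of a dual certificate: if the value of the primal problem is below `r`, then so is
that of the dual problem, at a functional that is nonnegative on the cone. -/
theorem exists_dual_certificate [Nonempty σ] {w : ι → ℝ} (hw : ∀ i, 0 < w i)
    (hw1 : ∑ i, w i = 1)
    {K : Set E} (hKc : IsClosed K) (hKadd : ∀ x ∈ K, ∀ y ∈ K, x + y ∈ K)
    (hKsmul : ∀ c : ℝ, 0 ≤ c → ∀ x ∈ K, c • x ∈ K) (hK0 : (0 : E) ∈ K)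
    {e : ι → σ → E} (he : ∀ i s, e i s ∈ K) {m : E →L[ℝ] ℝ} (hme : ∀ i s, m (e i s) = 1)
    (hmK : ∀ x ∈ K, 0 ≤ m x) {t : E} (hmt : m t = 1)
    (ht : ∀ ℓ : E →L[ℝ] ℝ, (∀ x ∈ K, 0 ≤ ℓ x) → 0 ≤ ℓ t) {r : ℝ}
    (hr : ∀ p : ι → σ → ℝ, (∀ i s, 0 ≤ p i s) → (∀ i, 0 < ∑ s, p i s) → ∀ k ∈ K,
      ∑ i, ∑ s, p i s • e i s + k = t → ∑ i, w i * Real.log (∑ s, p i s) < r) :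
    ∃ ℓ : E →L[ℝ] ℝ, ∃ c : ι → ℝ, (∀ x ∈ K, 0 ≤ ℓ x) ∧ ℓ t = 1 ∧ (∀ i, 0 < c i) ∧
      (∀ i s, c i ≤ ℓ (e i s)) ∧ ∑ i, w i * Real.log (w i / c i) < r := by
  classical
  set L : (ι → σ → ℝ) → E := fun p => ∑ i, ∑ s, p i s • e i s with hL
  have hLc : Continuous L := by fun_prop
  have hmL : ∀ p, m (L p) = ∑ i, ∑ s, p i s := by
    intro p; simp [hL, map_sum, hme]
  have hLadd : ∀ a b : ℝ, ∀ p q, L (a • p + b • q) = a • L p + b • L q := by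
    intro a b p q
    simp [hL, Finset.smul_sum, add_smul, Finset.sum_add_distrib, mul_smul]
  have hLK : ∀ p : ι → σ → ℝ, (∀ i s, 0 ≤ p i s) → 0 ≤ m (L p) := fun p hp => by
    rw [hmL]; exact Finset.sum_nonneg fun i _ => Finset.sum_nonneg fun s _ => hp i s
  set C := geomMeanSet σ w r with hC
  set Q : Set E := {x | ∃ p ∈ C, ∃ k ∈ K, L p + k = x} with hQ
  have hQconv : Convex ℝ Q := by
    rintro _ ⟨p, hp, k, hk, rfl⟩ _ ⟨q, hq, l, hl, rfl⟩ a b ha hb hab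
    refine ⟨a • p + b • q, convex_geomMeanSet hw r hp hq ha hb hab, a • k + b • l,
      hKadd _ (hKsmul a ha k hk) _ (hKsmul b hb l hl), ?_⟩
    rw [hLadd, smul_add, smul_add]; abel
  have hmQ : ∀ x ∈ Q, 0 ≤ m x := by
    rintro _ ⟨p, hp, k, hk, rfl⟩
    rw [map_add]
    exact add_nonneg (hLK p hp.1) (hmK k hk)
  -- `L '' C + K` need not be closed. But `m t = 1`, and on the open set `m < 2` the entries of `p`
  -- are at most `2`, so near `t` only a compact part of `C` matters, and compact plus closed is
  -- closed.
  have htQ : t ∉ closure Q := by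
    intro htc
    set C2 : Set (ι → σ → ℝ) := C ∩ Icc 0 (fun _ _ => 2)
    have hC2 : IsCompact C2 := (isCompact_Icc).inter_left (isClosed_geomMeanSet hw r)
    have hcl : IsClosed (L '' C2 + K) := hKc.add_left_of_isCompact (hC2.image hLc)
    have hsub : m ⁻¹' Iio 2 ∩ Q ⊆ L '' C2 + K := by
      rintro _ ⟨hm2, p, hp, k, hk, rfl⟩
      refine Set.add_mem_add ⟨p, ⟨hp, fun i s => hp.1 i s, fun i s => ?_⟩, rfl⟩ hk
      have h1 : m (L p) ≤ 2 := by
        have := hmK k hk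
        simp only [mem_preimage, map_add, mem_Iio] at hm2
        linarith
      rw [hmL] at h1
      refine le_trans ?_ h1
      refine le_trans ?_ (Finset.single_le_sum (f := fun i => ∑ s, p i s)
        (fun i _ => (hp.2.1 i).le) (Finset.mem_univ i))
      exact Finset.single_le_sum (fun s _ => hp.1 i s) (Finset.mem_univ s)
    have hopen : IsOpen (m ⁻¹' Iio (2 : ℝ)) := isOpen_Iio.preimage m.continuous
    have hmem : t ∈ closure (m ⁻¹' Iio 2 ∩ Q) :=
      hopen.inter_closure ⟨by simp [hmt], htc⟩
    obtain ⟨_, ⟨p, hp, rfl⟩, k, hk, hpk⟩ := closure_minimal hsub hcl hmem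
    exact absurd hp.1.2.2 (not_le.2 (hr p hp.1.1 hp.1.2.1 k hk hpk))
  obtain ⟨ℓ, u, hℓt, hℓQ⟩ :=
    geometric_hahn_banach_point_closed hQconv.closure isClosed_closure htQ
  replace hℓQ : ∀ x ∈ Q, u < ℓ x := fun x hx => hℓQ x (subset_closure hx)
  obtain ⟨s₀⟩ := ‹Nonempty σ›
  have htest : ∀ q : ι → ℝ, ∀ s : ι → σ, (∀ i, 0 < q i) → r ≤ ∑ i, w i * Real.log (q i) →
      (fun i j => if j = s i then q i else 0 : ι → σ → ℝ) ∈ C ∧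
      L (fun i j => if j = s i then q i else 0) = ∑ i, q i • e i (s i) := by
    intro q s hq hqr
    refine ⟨⟨fun i j => ?_, fun i => ?_, ?_⟩, ?_⟩
    · dsimp only; split_ifs; exacts [(hq i).le, le_rfl]
    · simpa using hq i
    · simpa using hqr
    · simp [hL, ite_smul]
  have hCne : ∃ p, p ∈ C := by
    refine ⟨_, (htest (fun _ => Real.exp r) (fun _ => s₀) (fun _ => Real.exp_pos r) ?_).1⟩
    simp [← Finset.sum_mul, hw1]
  -- `Q` is stable under adding elements of `K` and `ℓ` is bounded below on it.
  have hℓK : ∀ x ∈ K, 0 ≤ ℓ x := by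
    intro x hx
    by_contra! hneg
    obtain ⟨p, hp⟩ := hCne
    obtain ⟨n, hn⟩ := exists_nat_gt ((ℓ (L p) - u) / (-ℓ x))
    have h1 := hℓQ _ ⟨p, hp, (n : ℝ) • x, hKsmul n n.cast_nonneg x hx, rfl⟩
    rw [div_lt_iff₀ (by linarith)] at hn
    simp only [map_add, map_smul, smul_eq_mul] at h1
    linarith
  have hτ := ht ℓ hℓK
  have hu : 0 < u := hτ.trans_lt hℓt
  -- Adding `δ • m` makes the functional strictly positive on every `e i s`, and this `δ` makes its
  -- value at `t` exactly `u`, hence `1` after scaling.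
  set δ := u - ℓ t with hδ
  have hδ0 : 0 < δ := sub_pos.2 hℓt
  set ℓ' : E →L[ℝ] ℝ := u⁻¹ • (ℓ + δ • m) with hℓ'
  have hap : ∀ x, ℓ' x = u⁻¹ * (ℓ x + δ * m x) := fun x => rfl
  have hmin : ∀ i, ∃ s, ∀ s', ℓ' (e i s) ≤ ℓ' (e i s') := fun i =>
    Finite.exists_min (fun s => ℓ' (e i s))
  choose s hs using hmin
  have hpos : ∀ i, 0 < ℓ' (e i (s i)) := by
    intro i
    have := hℓK _ (he i (s i))
    rw [hap, hme]
    positivity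
  refine ⟨ℓ', fun i => ℓ' (e i (s i)), fun x hx => ?_, ?_, hpos, fun i => hs i, ?_⟩
  · have := hℓK x hx
    have := hmK x hx
    rw [hap]; positivity
  · rw [hap, hmt, hδ]; field_simp; ring
  -- Otherwise the weights `w i / c i`, put at the cheapest `s` of each row, lie in `C`. There `ℓ'`
  -- equals `∑ w i = 1`, so `ℓ + δ m = u`, although `ℓ > u` on `Q` and `m ≥ 0`.
  · by_contra! hge
    obtain ⟨h1, h2⟩ := htest (fun i => w i / ℓ' (e i (s i))) s
      (fun i => div_pos (hw i) (hpos i)) hge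
    have hmemQ : L (fun i j => if j = s i then w i / ℓ' (e i (s i)) else 0) ∈ Q :=
      ⟨_, h1, 0, hK0, add_zero _⟩
    have h3 := hℓQ _ hmemQ
    have h4 := hmQ _ hmemQ
    have h5 : ℓ' (L (fun i j => if j = s i then w i / ℓ' (e i (s i)) else 0)) = 1 := by
      rw [h2, map_sum, ← hw1]
      refine Finset.sum_congr rfl fun i _ => ?_
      rw [map_smul, smul_eq_mul, div_mul_cancel₀ _ (hpos i).ne']
    rw [hap, inv_mul_eq_iff_eq_mul₀ hu.ne', mul_one] at h5
    have := mul_nonneg hδ0.le h4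
    linarith

end Duality

/-! ### The cone of mass, first moment and higher moment -/

section PowerCone

/-- The cone of those `(m, b, a)` such that some nonnegative point carries, with mass `m`, a first
moment of at least `b` and a moment of order `1 + ε` of at most `a`. -/
def powerCone (ε : ℝ) : Set (ℝ × ℝ × ℝ) :=
  {x | 0 ≤ x.1 ∧ ∃ u, 0 ≤ u ∧ x.2.1 ≤ x.1 * u ∧ x.1 * u ^ (1 + ε) ≤ x.2.2}

variable {ε : ℝ}

/-- The cheapest admissible point is `u = b⁺ / m`; eliminating it leaves inequalities between
continuous functions, which also remain correct at `m = 0`, and so gives closedness. -/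
theorem mem_powerCone_iff (hε : 0 < ε) (x : ℝ × ℝ × ℝ) :
    x ∈ powerCone ε ↔ 0 ≤ x.1 ∧ 0 ≤ x.2.2 ∧ max x.2.1 0 ^ (1 + ε) ≤ x.2.2 * x.1 ^ ε := by
  obtain ⟨m, b, a⟩ := x
  simp only [powerCone, mem_ofPred_eq]
  refine and_congr_right fun hm => ?_
  have h1ε : 0 < 1 + ε := by linarith
  have hsplit : ∀ u, 0 ≤ u → (m * u) ^ (1 + ε) = m * u ^ (1 + ε) * m ^ ε := by
    intro u hu
    rw [Real.mul_rpow hm hu, Real.rpow_add_of_nonneg hm zero_le_one hε.le, Real.rpow_one]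
    ring
  constructor
  · rintro ⟨u, hu, hb, ha⟩
    refine ⟨le_trans (by positivity) ha, ?_⟩
    calc max b 0 ^ (1 + ε) ≤ (m * u) ^ (1 + ε) := by
          gcongr
          exact max_le hb (by positivity)
      _ = m * u ^ (1 + ε) * m ^ ε := hsplit u hu
      _ ≤ a * m ^ ε := by gcongr
  · rintro ⟨ha, hb⟩
    rcases hm.eq_or_lt with rfl | hm
    · refine ⟨0, le_rfl, ?_, by simpa using ha⟩
      rw [Real.zero_rpow hε.ne', mul_zero] at hb
      by_contra! hlt
      rw [zero_mul] at hlt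
      have : 0 < max b 0 ^ (1 + ε) := Real.rpow_pos_of_pos (lt_max_of_lt_left hlt) _
      linarith
    · have hu : 0 ≤ max b 0 / m := by positivity
      refine ⟨max b 0 / m, hu, ?_, ?_⟩
      · rw [mul_div_cancel₀ _ hm.ne']; exact le_max_left _ _
      · have h := hsplit _ hu
        rw [mul_div_cancel₀ _ hm.ne'] at h
        rw [h] at hb
        exact le_of_mul_le_mul_right hb (Real.rpow_pos_of_pos hm ε)

theorem isClosed_powerCone (hε : 0 < ε) : IsClosed (powerCone ε) := by
  have : powerCone ε = {x | 0 ≤ x.1 ∧ 0 ≤ x.2.2 ∧ max x.2.1 0 ^ (1 + ε) ≤ x.2.2 * x.1 ^ ε} := by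
    ext x; exact mem_powerCone_iff hε x
  rw [this]
  have h1 : Continuous fun x : ℝ × ℝ × ℝ => max x.2.1 0 ^ (1 + ε) :=
    (Real.continuous_rpow_const (by linarith)).comp (by fun_prop)
  have h2 : Continuous fun x : ℝ × ℝ × ℝ => x.2.2 * x.1 ^ ε :=
    Continuous.mul (by fun_prop) ((Real.continuous_rpow_const hε.le).comp continuous_fst)
  exact (isClosed_le continuous_const continuous_fst).inter
    ((isClosed_le continuous_const continuous_snd.snd).inter (isClosed_le h1 h2))

/-- Two point masses can be merged at their barycentre: the first moment is kept and, by convexity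
of `u ↦ u ^ (1 + ε)`, the higher moment does not grow. -/
theorem powerCone_add_mem (hε : 0 < ε) {x y : ℝ × ℝ × ℝ} (hx : x ∈ powerCone ε)
    (hy : y ∈ powerCone ε) : x + y ∈ powerCone ε := by
  obtain ⟨m, b, a⟩ := x
  obtain ⟨n, b', a'⟩ := y
  obtain ⟨hm, u, hu, hb, ha⟩ := hx
  obtain ⟨hn, u', hu', hb', ha'⟩ := hy
  simp only at hm hb ha hn hb' ha'
  refine ⟨add_nonneg hm hn, ?_⟩
  simp only [Prod.mk_add_mk]
  rcases (add_nonneg hm hn).eq_or_lt with h0 | h0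
  · have h1 : m = 0 := by linarith
    have h2 : n = 0 := by linarith
    subst h1 h2
    refine ⟨0, le_rfl, ?_, ?_⟩ <;> linarith
  · refine ⟨(m * u + n * u') / (m + n), by positivity, ?_, ?_⟩
    · rw [mul_div_cancel₀ _ h0.ne']; linarith
    · have hconv := (convexOn_rpow (p := 1 + ε) (by linarith)).2 hu hu'
        (show 0 ≤ m / (m + n) by positivity) (show 0 ≤ n / (m + n) by positivity)
        (by rw [← add_div, div_self h0.ne'])
      simp only [smul_eq_mul] at hconv
      calc (m + n) * ((m * u + n * u') / (m + n)) ^ (1 + ε)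
          = (m + n) * (m / (m + n) * u + n / (m + n) * u') ^ (1 + ε) := by
            congr 2; ring
        _ ≤ (m + n) * (m / (m + n) * u ^ (1 + ε) + n / (m + n) * u' ^ (1 + ε)) := by gcongr
        _ = m * u ^ (1 + ε) + n * u' ^ (1 + ε) := by field_simp
        _ ≤ a + a' := add_le_add ha ha'

theorem powerCone_smul_mem {c : ℝ} (hc : 0 ≤ c) {x : ℝ × ℝ × ℝ} (hx : x ∈ powerCone ε) :
    c • x ∈ powerCone ε := by
  obtain ⟨m, b, a⟩ := x
  obtain ⟨hm, u, hu, hb, ha⟩ := hx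
  simp only at hm hb ha
  refine ⟨mul_nonneg hc hm, u, hu, ?_, ?_⟩ <;>
    simp only [Prod.smul_mk, smul_eq_mul, mul_assoc] <;> gcongr

end PowerCone

/-! ### Variational description of conditional value-at-risk -/

section CondValueAtRisk

variable {π ε B : ℝ} {η : Measure ℝ}

theorem abs_le_one_add_rpow (hε : 0 < ε) (y : ℝ) : |y| ≤ 1 + |y| ^ (1 + ε) := by
  have h0 := abs_nonneg y
  rcases le_total |y| 1 with h | h
  · have := Real.rpow_nonneg h0 (1 + ε); linarith
  · have : |y| ^ (1 : ℝ) ≤ |y| ^ (1 + ε) := Real.rpow_le_rpow_of_exponent_le h (by linarith)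
    rw [Real.rpow_one] at this; linarith

theorem continuous_abs_rpow (hε : 0 < ε) : Continuous fun y : ℝ => |y| ^ (1 + ε) :=
  (Real.continuous_rpow_const (by linarith)).comp continuous_abs

theorem integrable_abs_rpow_of_mem (hε : 0 < ε) (h : η ∈ momentClass ε B) :
    Integrable (fun y => |y| ^ (1 + ε)) η := by
  refine ⟨(continuous_abs_rpow hε).aestronglyMeasurable, ?_⟩
  rw [hasFiniteIntegral_iff_ofReal (ae_of_all _ fun y => Real.rpow_nonneg (abs_nonneg y) _)]
  exact h.2.trans_lt ENNReal.ofReal_lt_top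

theorem integral_abs_rpow_le_of_mem (hε : 0 < ε) (hB : 0 ≤ B) (h : η ∈ momentClass ε B) :
    ∫ y, |y| ^ (1 + ε) ∂η ≤ B := by
  rw [← ENNReal.ofReal_le_ofReal_iff hB, ofReal_integral_eq_lintegral_ofReal
    (integrable_abs_rpow_of_mem hε h) (ae_of_all _ fun y => Real.rpow_nonneg (abs_nonneg y) _)]
  exact h.2

theorem integrable_id_of_mem (hε : 0 < ε) (h : η ∈ momentClass ε B) :
    Integrable (fun y : ℝ => y) η := by
  have := h.1
  refine Integrable.mono' ((integrable_const 1).add (integrable_abs_rpow_of_mem hε h))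
    aestronglyMeasurable_id (ae_of_all _ fun y => ?_)
  exact abs_le_one_add_rpow hε y

theorem integrable_max_sub [IsFiniteMeasure η] (h : Integrable (fun y : ℝ => y) η) (z : ℝ) :
    Integrable (fun y => max (y - z) 0) η :=
  (h.sub (integrable_const z)).sup (integrable_const 0)

theorem bddBelow_le_real_Iic [IsProbabilityMeasure η] (hπ : 0 < π) :
    BddBelow {z : ℝ | π ≤ η.real (Iic z)} := by
  obtain ⟨a, ha⟩ := ((tendsto_cdf_atBot η).eventually_lt_const hπ).exists
  refine ⟨a, fun z hz => ?_⟩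
  by_contra! hza
  have := monotone_cdf η hza.le
  rw [cdf_eq_real η z] at this
  linarith [show π ≤ η.real (Iic z) from hz]

theorem le_real_Iic_valueAtRisk [IsProbabilityMeasure η] (hπ : π ∈ Ioo (0 : ℝ) 1) :
    π ≤ η.real (Iic (valueAtRisk π η)) := by
  obtain ⟨b, hb⟩ := ((tendsto_cdf_atTop η).eventually_const_lt hπ.2).exists
  have hne : {z : ℝ | π ≤ η.real (Iic z)}.Nonempty := ⟨b, by
    rw [cdf_eq_real] at hb; exact hb.le⟩
  set q := valueAtRisk π η with hq
  have hgt : ∀ z ∈ Ioi q, π ≤ cdf η z := by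
    intro z hz
    obtain ⟨z', hz', hlt⟩ := (csInf_lt_iff (bddBelow_le_real_Iic hπ.1) hne).1 hz
    exact (show π ≤ η.real (Iic z') from hz').trans
      (cdf_eq_real η z' ▸ monotone_cdf η hlt.le)
  rw [← cdf_eq_real]
  have hr : Filter.Tendsto (cdf η) (nhdsWithin q (Ioi q)) (nhds (cdf η q)) :=
    ((cdf η).right_continuous q).mono_left (nhdsWithin_mono _ Ioi_subset_Ici_self)
  exact ge_of_tendsto hr (Filter.eventually_of_mem self_mem_nhdsWithin hgt)

theorem real_Iio_valueAtRisk_le [IsProbabilityMeasure η] (hπ : π ∈ Ioo (0 : ℝ) 1) :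
    η.real (Iio (valueAtRisk π η)) ≤ π := by
  set q := valueAtRisk π η with hq
  have hlt : ∀ z ∈ Iio q, cdf η z ≤ π := by
    intro z hz
    by_contra! hzπ
    rw [cdf_eq_real] at hzπ
    exact absurd (csInf_le (bddBelow_le_real_Iic hπ.1) hzπ.le) (not_le.2 hz)
  have hlim : Function.leftLim (cdf η) q ≤ π :=
    le_of_tendsto ((monotone_cdf η).tendsto_leftLim q)
      (Filter.eventually_of_mem self_mem_nhdsWithin hlt)
  have h := (cdf η).measure_Iio (tendsto_cdf_atBot η) q
  rw [measure_cdf, sub_zero] at h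
  rw [measureReal_def, h]
  exact ENNReal.toReal_le_of_le_ofReal hπ.1.le (ENNReal.ofReal_le_ofReal hlim)

theorem one_sub_mul_condValueAtRisk [IsProbabilityMeasure η] (hπ : π ∈ Ioo (0 : ℝ) 1)
    (h : Integrable (fun y : ℝ => y) η) :
    (1 - π) * (condValueAtRisk π η - valueAtRisk π η) =
      ∫ y, max (y - valueAtRisk π η) 0 ∂η := by
  have hp : (1 - π) ≠ 0 := by linarith [hπ.2]
  set q := valueAtRisk π η with hq
  have h1 : ∫ y, max (y - q) 0 ∂η = ∫ y in Ioi q, y ∂η - q * η.real (Ioi q) := by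
    have : (fun y => max (y - q) 0) = (Ioi q).indicator fun y => y - q := by
      ext y
      by_cases hy : q < y
      · rw [indicator_of_mem (show y ∈ Ioi q from hy), max_eq_left (by linarith)]
      · rw [indicator_of_notMem (show y ∉ Ioi q from hy), max_eq_right (by linarith)]
    rw [this, integral_indicator measurableSet_Ioi, integral_sub h.integrableOn
      (integrable_const q), setIntegral_const, smul_eq_mul, mul_comm q]
  have h2 : η.real (Iic q) = 1 - η.real (Ioi q) := by
    rw [← compl_Ioi, probReal_compl_eq_one_sub measurableSet_Ioi]
  rw [h1, condValueAtRisk, ← hq, h2]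
  field_simp
  ring

/-- The Rockafellar–Uryasev inequality, with equality at the value-at-risk `q`. The hinge functions
at `q` and `z` differ pointwise by at most `z - q` on a half-line starting at `q`, open or closed
according to the sign of `z - q`, and the mass of that half-line compares with `1 - π` in the right
direction. -/
theorem one_sub_mul_condValueAtRisk_le [IsProbabilityMeasure η] (hπ : π ∈ Ioo (0 : ℝ) 1)
    (h : Integrable (fun y : ℝ => y) η) (z : ℝ) :
    (1 - π) * (condValueAtRisk π η - z) ≤ ∫ y, max (y - z) 0 ∂η := by
  have h1 := one_sub_mul_condValueAtRisk hπ h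
  set q := valueAtRisk π η with hq
  have hiz := integrable_max_sub h z
  suffices hs : ∫ y, max (y - q) 0 ∂η ≤ ∫ y, max (y - z) 0 ∂η + (z - q) * (1 - π) by
    linarith
  rcases le_total q z with hz | hz
  · have hle : ∫ y, max (y - q) 0 ∂η ≤
        ∫ y, (max (y - z) 0 + (Ioi q).indicator (fun _ => z - q) y) ∂η := by
      refine integral_mono (integrable_max_sub h q)
        (hiz.add ((integrable_const _).indicator measurableSet_Ioi)) fun y => ?_
      by_cases hy : q < y
      · simp only [indicator_of_mem (show y ∈ Ioi q from hy)]
        rw [max_eq_left (by linarith)]; linarith [le_max_left (y - z) 0]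
      · simp only [indicator_of_notMem (show y ∉ Ioi q from hy)]
        rw [max_eq_right (by linarith)]; linarith [le_max_right (y - z) 0]
    rw [integral_add hiz ((integrable_const _).indicator measurableSet_Ioi),
      integral_indicator_const _ measurableSet_Ioi, smul_eq_mul, mul_comm (η.real _)] at hle
    refine hle.trans (add_le_add le_rfl (mul_le_mul_of_nonneg_left ?_ (sub_nonneg.2 hz)))
    rw [← compl_Iic, probReal_compl_eq_one_sub measurableSet_Iic]
    linarith [le_real_Iic_valueAtRisk (η := η) hπ]
  · have hle : ∫ y, max (y - q) 0 ∂η ≤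
        ∫ y, (max (y - z) 0 + (Ici q).indicator (fun _ => z - q) y) ∂η := by
      refine integral_mono (integrable_max_sub h q)
        (hiz.add ((integrable_const _).indicator measurableSet_Ici)) fun y => ?_
      by_cases hy : q ≤ y
      · simp only [indicator_of_mem (show y ∈ Ici q from hy)]
        rw [max_eq_left (by linarith)]; linarith [le_max_left (y - z) 0]
      · simp only [indicator_of_notMem (show y ∉ Ici q from hy)]
        rw [max_eq_right (by linarith)]; linarith [le_max_right (y - z) 0]
    rw [integral_add hiz ((integrable_const _).indicator measurableSet_Ici),
      integral_indicator_const _ measurableSet_Ici, smul_eq_mul, mul_comm (η.real _)] at hle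
    refine hle.trans (add_le_add le_rfl (mul_le_mul_of_nonpos_left ?_ (sub_nonpos.2 hz)))
    rw [← compl_Iio, probReal_compl_eq_one_sub measurableSet_Iio]
    linarith [real_Iio_valueAtRisk_le (η := η) hπ]

end CondValueAtRisk

/-! ### Finitely supported measures and their divergence -/

section DiscreteMeasure

variable {ι : Type*} [Fintype ι] {w x : ι → ℝ}

/-- The measure with mass `w i` at the point `x i`. -/
noncomputable def discreteMeasure (w x : ι → ℝ) : Measure ℝ :=
  ∑ i, ENNReal.ofReal (w i) • Measure.dirac (x i)

theorem discreteMeasure_apply {A : Set ℝ} (hA : MeasurableSet A) :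
    discreteMeasure w x A = ∑ i, ENNReal.ofReal (w i) * A.indicator 1 (x i) := by
  simp [discreteMeasure, Measure.dirac_apply' _ hA]

theorem isProbabilityMeasure_discreteMeasure (hw : ∀ i, 0 ≤ w i) (hw1 : ∑ i, w i = 1) :
    IsProbabilityMeasure (discreteMeasure w x) := by
  refine ⟨?_⟩
  rw [discreteMeasure_apply MeasurableSet.univ]
  simp only [indicator_univ, Pi.one_apply, mul_one]
  rw [← ENNReal.ofReal_sum_of_nonneg fun i _ => hw i, hw1, ENNReal.ofReal_one]

theorem integrable_smul_dirac (c a : ℝ) (f : ℝ → ℝ) :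
    Integrable f (ENNReal.ofReal c • Measure.dirac a) :=
  (integrable_dirac (by simp)).smul_measure ENNReal.ofReal_ne_top

theorem integrable_discreteMeasure (f : ℝ → ℝ) : Integrable f (discreteMeasure w x) :=
  integrable_finsetSum_measure.2 fun _ _ => integrable_smul_dirac _ _ f

theorem integral_discreteMeasure (hw : ∀ i, 0 ≤ w i) (f : ℝ → ℝ) :
    ∫ y, f y ∂discreteMeasure w x = ∑ i, w i * f (x i) := by
  rw [discreteMeasure, integral_finsetSum_measure fun _ _ => integrable_smul_dirac _ _ f]
  refine Finset.sum_congr rfl fun i _ => ?_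
  rw [integral_smul_measure, integral_dirac, ENNReal.toReal_ofReal (hw i), smul_eq_mul]

/-- Only an inequality, since points may coincide: the auxiliary atoms added to the empirical
support below can hit a sample. -/
theorem le_discreteMeasure_real_singleton (hw : ∀ i, 0 ≤ w i) (hw1 : ∑ i, w i = 1) (i : ι) :
    w i ≤ (discreteMeasure w x).real {x i} := by
  have := isProbabilityMeasure_discreteMeasure (x := x) hw hw1
  rw [measureReal_def, ← ENNReal.ofReal_le_iff_le_toReal (measure_ne_top _ _),
    discreteMeasure_apply (measurableSet_singleton _)]
  refine le_trans ?_ (Finset.single_le_sum (fun j _ => zero_le) (Finset.mem_univ i))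
  simp

theorem discreteMeasure_mem_momentClass {ε B : ℝ} (hw : ∀ i, 0 ≤ w i) (hw1 : ∑ i, w i = 1)
    (hB : ∑ i, w i * |x i| ^ (1 + ε) ≤ B) : discreteMeasure w x ∈ momentClass ε B := by
  refine ⟨isProbabilityMeasure_discreteMeasure hw hw1, ?_⟩
  rw [← ofReal_integral_eq_lintegral_ofReal (integrable_discreteMeasure _)
    (ae_of_all _ fun y => Real.rpow_nonneg (abs_nonneg y) _), integral_discreteMeasure hw]
  exact ENNReal.ofReal_le_ofReal hB

/-- A discrete measure has divergence at most `∑ w log (w / p)` from any probability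
measure that charges its atoms by at least `p`. -/
theorem klDiv_discreteMeasure_le {p : ι → ℝ} (hw : ∀ i, 0 < w i) (hw1 : ∑ i, w i = 1)
    (hx : Function.Injective x) (hp : ∀ i, 0 < p i) {κ : Measure ℝ} [IsProbabilityMeasure κ]
    (hκ : ∀ i, p i ≤ κ.real {x i}) :
    klDiv (discreteMeasure w x) κ ≤ ENNReal.ofReal (∑ i, w i * Real.log (w i / p i)) := by
  classical
  have hw0 := fun i => (hw i).le
  have := isProbabilityMeasure_discreteMeasure (x := x) hw0 hw1
  have hac : discreteMeasure w x ≪ κ := by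
    refine Measure.AbsolutelyContinuous.mk fun A hA h0 => ?_
    rw [discreteMeasure_apply hA]
    refine Finset.sum_eq_zero fun i _ => ?_
    by_cases hyA : x i ∈ A
    · have h1 : κ.real {x i} = 0 := by
        rw [measureReal_def, measure_mono_null (singleton_subset_iff.2 hyA) h0, ENNReal.toReal_zero]
      linarith [hp i, hκ i]
    · simp [hyA]
  rw [klDiv_of_ac_of_integrable hac (integrable_discreteMeasure _), integral_discreteMeasure hw0]
  simp only [probReal_univ, add_sub_cancel_right]
  refine ENNReal.ofReal_le_ofReal (Finset.sum_le_sum fun i _ =>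
    mul_le_mul_of_nonneg_left ?_ (hw i).le)
  have hκy : 0 < κ.real {x i} := (hp i).trans_le (hκ i)
  have hd : ((discreteMeasure w x).rnDeriv κ (x i)).toReal * κ.real {x i} = w i := by
    have h := Measure.setLIntegral_rnDeriv hac {x i}
    rw [lintegral_singleton, discreteMeasure_apply (measurableSet_singleton _),
      Finset.sum_eq_single_of_mem i (Finset.mem_univ i)
        (fun j _ hj => by simp [hx.ne hj])] at h
    rw [measureReal_def, ← ENNReal.toReal_mul, h]
    simp [hw0 i]
  rw [← eq_div_iff hκy.ne'] at hd
  rw [llr_def]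
  simp only [hd]
  exact Real.log_le_log (div_pos (hw i) hκy)
    (div_le_div_of_nonneg_left (hw i).le (hp i) (hκ i))

end DiscreteMeasure

/-! ### Dual functions and their means under the true distribution -/

section DualFunctions

variable {π ε B : ℝ}

/-- The dual function of the problem defining `klInfU`, at the parameter `(θ, β, γ)`. -/
noncomputable def upperDualFn (π ε B v y : ℝ) (l : ℝ × ℝ × ℝ) : ℝ :=
  1 + l.2.2 * (|y| ^ (1 + ε) - B) - (1 - π) * (l.1 + l.2.1 * v) + min 0 (l.1 + l.2.1 * y)

/-- The dual function of the problem defining `klInfL` with the value-at-risk fixed to be `z`,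
at the parameter `(β, γ)`. -/
noncomputable def lowerDualFn (π ε B v z y : ℝ) (l : ℝ × ℝ) : ℝ :=
  1 + l.2 * (|y| ^ (1 + ε) - B) + l.1 * (max (y - z) 0 - (1 - π) * (v - z))

/-- The feasible parameters of `upperDualFn`. -/
def upperDualSet (π ε B v : ℝ) : Set (ℝ × ℝ × ℝ) :=
  {l | 0 ≤ l.2.2 ∧ ∀ y, 0 ≤ upperDualFn π ε B v y l}

/-- The feasible parameters of `lowerDualFn`. -/
def lowerDualSet (π ε B v z : ℝ) : Set (ℝ × ℝ) :=
  {l | 0 ≤ l.2 ∧ ∀ y, 0 ≤ lowerDualFn π ε B v z y l}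

theorem integrable_min_zero_affine {η : Measure ℝ} [IsFiniteMeasure η]
    (h : Integrable (fun y : ℝ => y) η) (θ β : ℝ) :
    Integrable (fun y => min 0 (θ + β * y)) η :=
  (integrable_const 0).inf ((integrable_const θ).add (h.const_mul β))

/-- The conditional value-at-risk is the mean of a tail of mass `1 - π`. -/
theorem integral_min_zero_affine_le {η : Measure ℝ} [IsProbabilityMeasure η]
    (hπ : π ∈ Ioo (0 : ℝ) 1) (h : Integrable (fun y : ℝ => y) η) (θ β : ℝ) :
    ∫ y, min 0 (θ + β * y) ∂η ≤ (1 - π) * (θ + β * condValueAtRisk π η) := by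
  have hp : (1 - π) ≠ 0 := by linarith [hπ.2]
  have hq1 := le_real_Iic_valueAtRisk (η := η) hπ
  have hq2 := real_Iio_valueAtRisk_le (η := η) hπ
  rw [condValueAtRisk]
  set q := valueAtRisk π η with hq
  have hsplit : η.real (Iic q) = η.real (Iio q) + η.real {q} := by
    rw [← Iio_union_right, measureReal_union (by simp) (measurableSet_singleton q)]
  -- `ρ` is the fraction of the atom at `q` given to the tail so that the tail has mass exactly `1 -
  -- π`. Since `ρ ∈ [0, 1]`, `min 0 f` lies below `f` weighted by the tail indicator.
  obtain ⟨ρ, hρ0, hρ1, hρ⟩ : ∃ ρ : ℝ, 0 ≤ ρ ∧ ρ ≤ 1 ∧ ρ * η.real {q} = η.real (Iic q) - π := by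
    rcases (measureReal_nonneg (μ := η) (s := {q})).eq_or_lt with h0 | h0
    · exact ⟨0, le_rfl, zero_le_one, by linarith⟩
    · exact ⟨(η.real (Iic q) - π) / η.real {q}, div_nonneg (by linarith) h0.le,
        (div_le_one h0).2 (by linarith), div_mul_cancel₀ _ h0.ne'⟩
  have haff : Integrable (fun y => θ + β * y) η := (integrable_const θ).add (h.const_mul β)
  have hi1 := haff.indicator (measurableSet_Ioi (a := q))
  have hi2 := (integrable_const (μ := η) (ρ * (θ + β * q))).indicator (measurableSet_singleton q)
  have hle : ∫ y, min 0 (θ + β * y) ∂η ≤ ∫ y, ((Ioi q).indicator (fun y => θ + β * y) y +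
      ({q} : Set ℝ).indicator (fun _ => ρ * (θ + β * q)) y) ∂η := by
    refine integral_mono (integrable_min_zero_affine h θ β) (hi1.add hi2) fun y => ?_
    rcases lt_trichotomy y q with hy | hy | hy
    · simp [hy.le.not_gt, hy.ne]
    · subst hy
      simp only [mem_Ioi, lt_self_iff_false, not_false_eq_true, indicator_of_notMem,
        mem_singleton_iff, indicator_of_mem, zero_add]
      rcases le_total 0 (θ + β * q) with ha | ha
      · rw [min_eq_left ha]; positivity
      · rw [min_eq_right ha]; nlinarith
    · simp [hy, hy.ne']
  rw [integral_add hi1 hi2, integral_indicator measurableSet_Ioi,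
    integral_indicator_const _ (measurableSet_singleton q),
    integral_add (integrable_const θ) (h.const_mul β).integrableOn, setIntegral_const,
    integral_const_mul, smul_eq_mul, smul_eq_mul, ← compl_Iic,
    probReal_compl_eq_one_sub measurableSet_Iic] at hle
  refine hle.trans (le_of_eq ?_)
  rw [compl_Iic]
  have : η.real {q} * (ρ * (θ + β * q)) = (η.real (Iic q) - π) * (θ + β * q) := by
    rw [← hρ]; ring
  rw [this]
  field_simp
  ring

theorem integrable_upperDualFn {η : Measure ℝ} (hε : 0 < ε) (h : η ∈ momentClass ε B) (v : ℝ)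
    (l : ℝ × ℝ × ℝ) : Integrable (fun y => upperDualFn π ε B v y l) η := by
  have := h.1
  exact (((integrable_const _).add (((integrable_abs_rpow_of_mem hε h).sub
    (integrable_const B)).const_mul _)).sub (integrable_const _)).add
      (integrable_min_zero_affine (integrable_id_of_mem hε h) _ _)

/-- The moment term has nonpositive mean, and the `min` term is compensated by `(1 - π)(θ + β v)`.
Only `0 ≤ γ` is needed, not positivity of the dual function; this generality is used inside the
duality proof itself. -/
theorem integral_upperDualFn_le {η : Measure ℝ} (hπ : π ∈ Ioo (0 : ℝ) 1) (hε : 0 < ε)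
    (hB : 0 ≤ B) (h : η ∈ momentClass ε B) {l : ℝ × ℝ × ℝ} (hl : 0 ≤ l.2.2) :
    ∫ y, upperDualFn π ε B (condValueAtRisk π η) y l ∂η ≤ 1 := by
  have := h.1
  have hf := integrable_abs_rpow_of_mem hε h
  have hid := integrable_id_of_mem hε h
  have h1 := integral_min_zero_affine_le hπ hid l.1 l.2.1
  have h2 := mul_le_mul_of_nonneg_left (integral_abs_rpow_le_of_mem hε hB h) hl
  have hi1 : Integrable (fun y => l.2.2 * (|y| ^ (1 + ε) - B)) η :=
    (hf.sub (integrable_const B)).const_mul _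
  have hi2 : Integrable (fun y => 1 + l.2.2 * (|y| ^ (1 + ε) - B)) η :=
    (integrable_const _).add hi1
  have hi3 : Integrable (fun y => 1 + l.2.2 * (|y| ^ (1 + ε) - B) -
      (1 - π) * (l.1 + l.2.1 * condValueAtRisk π η)) η := hi2.sub (integrable_const _)
  unfold upperDualFn
  rw [integral_add hi3 (integrable_min_zero_affine hid _ _),
    integral_sub hi2 (integrable_const _),
    integral_add (integrable_const _) hi1, integral_const_mul, integral_sub hf (integrable_const _)]
  simp only [integral_const, probReal_univ, one_smul]
  linarith

theorem integrable_lowerDualFn {η : Measure ℝ} (hε : 0 < ε) (h : η ∈ momentClass ε B) (v z : ℝ)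
    (l : ℝ × ℝ) : Integrable (fun y => lowerDualFn π ε B v z y l) η := by
  have := h.1
  exact ((integrable_const _).add (((integrable_abs_rpow_of_mem hε h).sub
    (integrable_const B)).const_mul _)).add
      (((integrable_max_sub (integrable_id_of_mem hε h) z).sub (integrable_const _)).const_mul _)

theorem integral_lowerDualFn_le {η : Measure ℝ} (hπ : π ∈ Ioo (0 : ℝ) 1) (hε : 0 < ε)
    (hB : 0 ≤ B) (h : η ∈ momentClass ε B) {l : ℝ × ℝ} (hl : 0 ≤ l.2) :
    ∫ y, lowerDualFn π ε B (condValueAtRisk π η) (valueAtRisk π η) y l ∂η ≤ 1 := by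
  have := h.1
  have hf := integrable_abs_rpow_of_mem hε h
  have hid := integrable_id_of_mem hε h
  have hm := integrable_max_sub hid (valueAtRisk π η)
  have h1 := one_sub_mul_condValueAtRisk hπ hid
  have h2 := mul_le_mul_of_nonneg_left (integral_abs_rpow_le_of_mem hε hB h) hl
  have hi1 : Integrable (fun y => l.2 * (|y| ^ (1 + ε) - B)) η :=
    (hf.sub (integrable_const B)).const_mul _
  have hi2 : Integrable (fun y => 1 + l.2 * (|y| ^ (1 + ε) - B)) η :=
    (integrable_const _).add hi1
  have hi3 : Integrable (fun y => l.1 * (max (y - valueAtRisk π η) 0 -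
      (1 - π) * (condValueAtRisk π η - valueAtRisk π η))) η :=
    (hm.sub (integrable_const _)).const_mul _
  unfold lowerDualFn
  rw [integral_add hi2 hi3,
    integral_add (integrable_const _) hi1, integral_const_mul, integral_const_mul,
    integral_sub hf (integrable_const _), integral_sub hm (integrable_const _), ← h1]
  simp only [integral_const, probReal_univ, one_smul]
  linarith

end DualFunctions

/-! ### Dual certificates for the two divergence infima -/

section StrongDuality

variable {π ε B : ℝ} {ι : Type*} [Fintype ι] {w x : ι → ℝ}

/-- A competitor `κ` is split into a lower part and a tail. The coordinates record the mass of the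
lower part, the mass of the tail, the first moment of the tail and the moment of order `1 + ε`. The
cone `K` accounts for mass off the support of `η` and for slack: extra lower mass sits at `0`, where
it costs no moment, and extra tail mass at a single point `u ≥ 0`. -/
theorem exists_upperDualFn_lt (hπ : π ∈ Ioo (0 : ℝ) 1) (hε : 0 < ε) (hB : 0 ≤ B) {μ : Measure ℝ}
    (hμ : μ ∈ momentClass ε B) (hw : ∀ i, 0 < w i) (hw1 : ∑ i, w i = 1)
    (hx : Function.Injective x) {D : ℝ} (hD : 0 ≤ D)
    (hlt : ENNReal.ofReal D < klInfU π ε B (discreteMeasure w x) (condValueAtRisk π μ)) :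
    ∃ l ∈ upperDualSet π ε B (condValueAtRisk π μ),
      (∀ i, 0 < upperDualFn π ε B (condValueAtRisk π μ) (x i) l) ∧
      D < ∑ i, w i * Real.log (upperDualFn π ε B (condValueAtRisk π μ) (x i) l) := by
  have hmean := fun l hl => integral_upperDualFn_le (l := l) hπ hε hB hμ hl
  have := hμ.1
  set v := condValueAtRisk π μ with hv
  have h1ε : 1 + ε ≠ 0 := by linarith
  set K : Set (ℝ × ℝ × ℝ × ℝ) := {x | 0 ≤ x.1 ∧ x.2 ∈ powerCone ε} with hK
  have hKc : IsClosed K := (isClosed_le continuous_const continuous_fst).inter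
    ((isClosed_powerCone hε).preimage continuous_snd)
  have he0 : ∀ y : ℝ, ((1, 0, 0, |y| ^ (1 + ε)) : ℝ × ℝ × ℝ × ℝ) ∈ K := fun y =>
    ⟨zero_le_one, le_rfl, 0, le_rfl, by simp, by simp; positivity⟩
  have he1 : ∀ y : ℝ, ((0, 1, y, |y| ^ (1 + ε)) : ℝ × ℝ × ℝ × ℝ) ∈ K := fun y =>
    ⟨le_rfl, zero_le_one, |y|, abs_nonneg y, by simp [le_abs_self], by simp⟩
  have hea : ((0, 0, 0, 1) : ℝ × ℝ × ℝ × ℝ) ∈ K :=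
    ⟨le_rfl, le_rfl, 0, le_rfl, by simp, by simp⟩
  have hlin : ∀ ℓ : ℝ × ℝ × ℝ × ℝ →L[ℝ] ℝ, ∀ a b c d : ℝ, ℓ (a, b, c, d) =
      a * ℓ (1, 0, 0, 0) + b * ℓ (0, 1, 0, 0) + c * ℓ (0, 0, 1, 0) + d * ℓ (0, 0, 0, 1) := by
    intro ℓ a b c d
    have : ((a, b, c, d) : ℝ × ℝ × ℝ × ℝ) = a • (1, 0, 0, 0) + b • (0, 1, 0, 0) +
        c • (0, 0, 1, 0) + d • (0, 0, 0, 1) := by simp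
    rw [this]; simp only [map_add, map_smul, smul_eq_mul]
  set t : ℝ × ℝ × ℝ × ℝ := (π, 1 - π, (1 - π) * v, B) with ht
  set par : (ℝ × ℝ × ℝ × ℝ →L[ℝ] ℝ) → ℝ × ℝ × ℝ := fun ℓ =>
    (ℓ (0, 1, 0, 0) - ℓ (1, 0, 0, 0), ℓ (0, 0, 1, 0), ℓ (0, 0, 0, 1)) with hpar
  have hfn : ∀ ℓ y, upperDualFn π ε B v y (par ℓ) =
      1 - ℓ t + min (ℓ (1, 0, 0, |y| ^ (1 + ε))) (ℓ (0, 1, y, |y| ^ (1 + ε))) := by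
    intro ℓ y
    rw [hlin ℓ 1 0 0 _, hlin ℓ 0 1 y _, hlin ℓ π _ _ _]
    simp only [upperDualFn, hpar]
    rcases le_total 0 (ℓ (0, 1, 0, 0) - ℓ (1, 0, 0, 0) + ℓ (0, 0, 1, 0) * y) with h | h
    · rw [min_eq_left h, min_eq_left (by linarith)]; ring
    · rw [min_eq_right h, min_eq_right (by linarith)]; ring
  -- `μ` is feasible, so a functional nonnegative on `K` is nonnegative at `t`: by `hfn`, the bound
  -- `1` on the mean of the dual function says that `ℓ t` dominates the mean of a nonnegative
  -- minimum.
  have htK : ∀ ℓ : ℝ × ℝ × ℝ × ℝ →L[ℝ] ℝ, (∀ x ∈ K, 0 ≤ ℓ x) → 0 ≤ ℓ t := by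
    intro ℓ hℓ
    have h1 := hmean (par ℓ) (hℓ _ hea)
    have h2 : ∫ _, (1 - ℓ t) ∂μ ≤ ∫ y, upperDualFn π ε B v y (par ℓ) ∂μ := by
      refine integral_mono (integrable_const _) (integrable_upperDualFn hε hμ v _) fun y => ?_
      simp only [hfn]
      linarith [le_min (hℓ _ (he0 y)) (hℓ _ (he1 y))]
    simp only [integral_const, probReal_univ, one_smul] at h2
    linarith
  obtain ⟨ℓ, c, hℓK, hℓt, hc, hce, hsum⟩ := exists_dual_certificate hw hw1 hKc
    (fun x hx y hy => ⟨add_nonneg hx.1 hy.1, powerCone_add_mem hε hx.2 hy.2⟩)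
    (fun a ha x hx => ⟨mul_nonneg ha hx.1, powerCone_smul_mem ha hx.2⟩)
    ⟨le_rfl, le_rfl, 0, le_rfl, by simp, by simp⟩
    (e := fun i (s : Bool) => if s then (0, 1, x i, |x i| ^ (1 + ε)) else
      (1, 0, 0, |x i| ^ (1 + ε)))
    (fun i s => by cases s; exacts [he0 _, he1 _])
    (m := ContinuousLinearMap.fst ℝ ℝ (ℝ × ℝ × ℝ) +
      (ContinuousLinearMap.fst ℝ ℝ (ℝ × ℝ)).comp (ContinuousLinearMap.snd ℝ ℝ (ℝ × ℝ × ℝ)))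
    (fun i s => by cases s <;> simp)
    (fun x hx => add_nonneg hx.1 hx.2.1) (t := t) (by simp [ht]) htK
    -- The divergence of `η` from a measure with atoms `p` is at most `∑ w log w - ∑ w log p`, so a
    -- divergence above `D` forces `∑ w log p` below this `r`.
    (r := ∑ i, w i * Real.log (w i) - D) (by
      rintro p hp0 hp1 ⟨k0, k1, kb, ka⟩ ⟨hk0, hk1, u, hu, hub, hua⟩ hpk
      simp only at hk0 hk1 hub hua
      have e0 := congrArg (fun x => x.1) hpk
      have e1 := congrArg (fun x => x.2.1) hpk
      have e2 := congrArg (fun x => x.2.2.1) hpk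
      have e3 := congrArg (fun x => x.2.2.2) hpk
      simp [ht, Prod.fst_sum, Prod.snd_sum, Finset.sum_add_distrib] at e0 e1 e2 e3
      simp only [Fintype.sum_bool] at hp1 ⊢
      set q : ι ⊕ Fin 2 → ℝ := Sum.elim (fun i => p i true + p i false) ![k0, k1] with hq
      set a : ι ⊕ Fin 2 → ℝ := Sum.elim x ![0, u] with ha
      have hq0 : ∀ i, 0 ≤ q i := by
        rintro (i | i)
        · exact (hp1 i).le
        · fin_cases i; exacts [hk0, hk1]
      have hqsum : ∀ f : ℝ → ℝ, ∑ i, q i * f (a i) =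
          ∑ i, (p i true + p i false) * f (x i) + (k0 * f 0 + k1 * f u) := by
        intro f; simp [hq, ha, Fintype.sum_sum_type]
      have hq1 : ∑ i, q i = 1 := by
        have := hqsum (fun _ => 1)
        simp only [mul_one, Finset.sum_add_distrib] at this
        rw [this]; linarith
      have hκ : discreteMeasure q a ∈ momentClass ε B := by
        refine discreteMeasure_mem_momentClass hq0 hq1 ?_
        rw [hqsum fun y => |y| ^ (1 + ε)]
        simp only [abs_zero, Real.zero_rpow h1ε, mul_zero, zero_add, abs_of_nonneg hu, add_mul,
          Finset.sum_add_distrib]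
        linarith
      have := hκ.1
      have hcv : v ≤ condValueAtRisk π (discreteMeasure q a) := by
        have h1 := one_sub_mul_condValueAtRisk hπ (integrable_discreteMeasure (w := q) (x := a) _)
        set z := valueAtRisk π (discreteMeasure q a)
        rw [integral_discreteMeasure hq0, hqsum fun y => max (y - z) 0] at h1
        have h2 : ∑ i, p i true * (x i - z) ≤
            ∑ i, (p i true + p i false) * max (x i - z) 0 := by
          refine Finset.sum_le_sum fun i _ => ?_
          have := mul_le_mul_of_nonneg_left (le_max_left (x i - z) 0) (hp0 i true)
          have := mul_nonneg (hp0 i false) (le_max_right (x i - z) 0)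
          linarith
        have h3 := mul_nonneg hk0 (le_max_right (0 - z) 0)
        have h4 := mul_le_mul_of_nonneg_left (le_max_left (u - z) 0) hk1
        simp only [mul_sub, Finset.sum_sub_distrib, ← Finset.sum_mul] at h2
        rw [eq_sub_of_add_eq e1] at h2
        have h5 : (1 - π) * v ≤ (1 - π) * condValueAtRisk π (discreteMeasure q a) := by
          linarith
        exact le_of_mul_le_mul_left h5 (by linarith [hπ.2])
      have hkl := hlt.trans_le ((iInf₂_le (discreteMeasure q a) ⟨hκ, hcv⟩).trans
        (klDiv_discreteMeasure_le hw hw1 hx hp1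
          fun i => le_discreteMeasure_real_singleton hq0 hq1 (Sum.inl i)))
      have hkl' := (ENNReal.ofReal_lt_ofReal_iff_of_nonneg hD).1 hkl
      have : ∀ i, w i * Real.log (w i / (p i true + p i false)) =
          w i * Real.log (w i) - w i * Real.log (p i true + p i false) := fun i => by
        rw [Real.log_div (hw i).ne' (hp1 i).ne', mul_sub]
      simp only [this, Finset.sum_sub_distrib] at hkl'
      linarith)
  have hg : ∀ y, upperDualFn π ε B v y (par ℓ) =
      min (ℓ (1, 0, 0, |y| ^ (1 + ε))) (ℓ (0, 1, y, |y| ^ (1 + ε))) := fun y => by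
    rw [hfn, hℓt]; ring
  have hcg : ∀ i, c i ≤ upperDualFn π ε B v (x i) (par ℓ) := fun i => by
    rw [hg]; exact le_min (hce i false) (hce i true)
  refine ⟨par ℓ, ⟨hℓK _ hea, fun y => ?_⟩, fun i => (hc i).trans_le (hcg i), ?_⟩
  · rw [hg]; exact le_min (hℓK _ (he0 y)) (hℓK _ (he1 y))
  · have : ∀ i, w i * Real.log (w i / c i) = w i * Real.log (w i) - w i * Real.log (c i) :=
      fun i => by rw [Real.log_div (hw i).ne' (hc i).ne', mul_sub]
    simp only [this, Finset.sum_sub_distrib] at hsum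
    have hle : ∑ i, w i * Real.log (c i) ≤
        ∑ i, w i * Real.log (upperDualFn π ε B v (x i) (par ℓ)) :=
      Finset.sum_le_sum fun i _ =>
        mul_le_mul_of_nonneg_left (Real.log_le_log (hc i) (hcg i)) (hw i).le
    linarith

/-- With `z` fixed at the value-at-risk of `μ`, the sufficient constraint `E (Y - z)⁺ ≤ (1 - π)(v -
z)` is linear in the competitor. The coordinates are mass, moment of order `1 + ε` and excess over
`z`. -/
theorem exists_lowerDualFn_lt (hπ : π ∈ Ioo (0 : ℝ) 1) (hε : 0 < ε) (hB : 0 ≤ B) {μ : Measure ℝ}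
    (hμ : μ ∈ momentClass ε B) (hw : ∀ i, 0 < w i) (hw1 : ∑ i, w i = 1)
    (hx : Function.Injective x) {D : ℝ} (hD : 0 ≤ D)
    (hlt : ENNReal.ofReal D < klInfL π ε B (discreteMeasure w x) (condValueAtRisk π μ)) :
    ∃ l ∈ lowerDualSet π ε B (condValueAtRisk π μ) (valueAtRisk π μ),
      (∀ i, 0 < lowerDualFn π ε B (condValueAtRisk π μ) (valueAtRisk π μ) (x i) l) ∧
      D < ∑ i, w i *
        Real.log (lowerDualFn π ε B (condValueAtRisk π μ) (valueAtRisk π μ) (x i) l) := by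
  have hmean := fun l hl => integral_lowerDualFn_le (l := l) hπ hε hB hμ hl
  have := hμ.1
  set v := condValueAtRisk π μ with hv
  set z := valueAtRisk π μ with hz
  have h1ε : 1 + ε ≠ 0 := by linarith
  -- Extra mass `m` is placed at `-u ≤ 0`. Its excess `m (-u - z)⁺` is at most `c` exactly when `0 ≤
  -- c` and `-c - m z ≤ m u`, which is the first-moment condition of the power cone.
  set K : Set (ℝ × ℝ × ℝ) := {x | 0 ≤ x.2.2 ∧ (x.1, -x.2.2 - x.1 * z, x.2.1) ∈ powerCone ε}
    with hK
  have hKc : IsClosed K := (isClosed_le continuous_const continuous_snd.snd).inter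
    ((isClosed_powerCone hε).preimage (by fun_prop))
  have hKadd : ∀ x ∈ K, ∀ y ∈ K, x + y ∈ K := by
    rintro ⟨m, a, c⟩ hx ⟨m', a', c'⟩ hy
    refine ⟨add_nonneg hx.1 hy.1, ?_⟩
    have h := powerCone_add_mem hε hx.2 hy.2
    simp only [Prod.mk_add_mk] at h ⊢
    rwa [show -(c + c') - (m + m') * z = -c - m * z + (-c' - m' * z) by ring]
  have hKsmul : ∀ b : ℝ, 0 ≤ b → ∀ x ∈ K, b • x ∈ K := by
    rintro b hb ⟨m, a, c⟩ hx
    refine ⟨mul_nonneg hb hx.1, ?_⟩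
    have h := powerCone_smul_mem hb hx.2
    simp only [Prod.smul_mk, smul_eq_mul] at h ⊢
    rwa [show -(b * c) - b * m * z = b * (-c - m * z) by ring]
  have he : ∀ y : ℝ, ((1, |y| ^ (1 + ε), max (y - z) 0) : ℝ × ℝ × ℝ) ∈ K := fun y =>
    ⟨le_max_right _ _, zero_le_one, |y|, abs_nonneg y, by
      simp only [one_mul]; linarith [le_max_left (y - z) 0, neg_abs_le y], by simp⟩
  have hea : ((0, 1, 0) : ℝ × ℝ × ℝ) ∈ K :=
    ⟨le_rfl, le_rfl, 0, le_rfl, by simp, by simp⟩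
  have hlin : ∀ ℓ : ℝ × ℝ × ℝ →L[ℝ] ℝ, ∀ a b c : ℝ, ℓ (a, b, c) =
      a * ℓ (1, 0, 0) + b * ℓ (0, 1, 0) + c * ℓ (0, 0, 1) := by
    intro ℓ a b c
    have : ((a, b, c) : ℝ × ℝ × ℝ) = a • (1, 0, 0) + b • (0, 1, 0) + c • (0, 0, 1) := by simp
    rw [this]; simp only [map_add, map_smul, smul_eq_mul]
  set t : ℝ × ℝ × ℝ := (1, B, (1 - π) * (v - z)) with ht
  set par : (ℝ × ℝ × ℝ →L[ℝ] ℝ) → ℝ × ℝ := fun ℓ => (ℓ (0, 0, 1), ℓ (0, 1, 0)) with hpar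
  have hfn : ∀ ℓ y, lowerDualFn π ε B v z y (par ℓ) =
      1 - ℓ t + ℓ (1, |y| ^ (1 + ε), max (y - z) 0) := by
    intro ℓ y
    rw [hlin ℓ 1 (|y| ^ (1 + ε)) _, hlin ℓ 1 B _]
    simp only [lowerDualFn, hpar]
    ring
  have htK : ∀ ℓ : ℝ × ℝ × ℝ →L[ℝ] ℝ, (∀ x ∈ K, 0 ≤ ℓ x) → 0 ≤ ℓ t := by
    intro ℓ hℓ
    have h1 := hmean (par ℓ) (hℓ _ hea)
    have h2 : ∫ _, (1 - ℓ t) ∂μ ≤ ∫ y, lowerDualFn π ε B v z y (par ℓ) ∂μ := by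
      refine integral_mono (integrable_const _) (integrable_lowerDualFn hε hμ v z _) fun y => ?_
      simp only [hfn]
      linarith [hℓ _ (he y)]
    simp only [integral_const, probReal_univ, one_smul] at h2
    linarith
  obtain ⟨ℓ, c, hℓK, hℓt, hc, hce, hsum⟩ := exists_dual_certificate hw hw1 hKc
    hKadd hKsmul
    ⟨le_rfl, le_rfl, 0, le_rfl, by simp, by simp⟩
    (e := fun i (_ : Unit) => (1, |x i| ^ (1 + ε), max (x i - z) 0))
    (fun i _ => he _)
    (m := ContinuousLinearMap.fst ℝ ℝ (ℝ × ℝ))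
    (fun i _ => by simp)
    (fun x hx => hx.2.1) (t := t) (by simp [ht]) htK
    (r := ∑ i, w i * Real.log (w i) - D) (by
      rintro p hp0 hp1 ⟨k, ka, kc⟩ ⟨hkc, hk, u, hu, hub, hua⟩ hpk
      simp only at hkc hk hub hua
      have e0 := congrArg (fun x => x.1) hpk
      have e1 := congrArg (fun x => x.2.1) hpk
      have e2 := congrArg (fun x => x.2.2) hpk
      simp [ht, Prod.fst_sum, Prod.snd_sum] at e0 e1 e2
      simp only [Finset.univ_unique, Finset.sum_singleton, PUnit.default_eq_unit] at hp1 ⊢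
      set q : ι ⊕ Unit → ℝ := Sum.elim (fun i => p i ()) (fun _ => k) with hq
      set a : ι ⊕ Unit → ℝ := Sum.elim x (fun _ => -u) with ha
      have hq0 : ∀ i, 0 ≤ q i := by
        rintro (i | i)
        exacts [(hp1 i).le, hk]
      have hqsum : ∀ f : ℝ → ℝ, ∑ i, q i * f (a i) = ∑ i, p i () * f (x i) + k * f (-u) := by
        intro f; simp [hq, ha, Fintype.sum_sum_type]
      have hq1 : ∑ i, q i = 1 := by
        have := hqsum (fun _ => 1)
        simp only [mul_one] at this
        rw [this]; linarith
      have hκ : discreteMeasure q a ∈ momentClass ε B := by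
        refine discreteMeasure_mem_momentClass hq0 hq1 ?_
        rw [hqsum fun y => |y| ^ (1 + ε)]
        simp only [abs_neg, abs_of_nonneg hu]
        linarith
      have := hκ.1
      have hcv : condValueAtRisk π (discreteMeasure q a) ≤ v := by
        have h1 := one_sub_mul_condValueAtRisk_le hπ
          (integrable_discreteMeasure (w := q) (x := a) _) z
        rw [integral_discreteMeasure hq0, hqsum fun y => max (y - z) 0] at h1
        have h2 : k * max (-u - z) 0 ≤ kc := by
          rw [mul_max_of_nonneg _ _ hk]
          exact max_le (by linarith) (by linarith)
        have h5 : (1 - π) * (condValueAtRisk π (discreteMeasure q a) - z) ≤ (1 - π) * (v - z) := by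
          linarith
        linarith [le_of_mul_le_mul_left h5 (by linarith [hπ.2])]
      have hkl := hlt.trans_le ((iInf₂_le (discreteMeasure q a) ⟨hκ, hcv⟩).trans
        (klDiv_discreteMeasure_le hw hw1 hx hp1
          fun i => le_discreteMeasure_real_singleton hq0 hq1 (Sum.inl i)))
      have hkl' := (ENNReal.ofReal_lt_ofReal_iff_of_nonneg hD).1 hkl
      have : ∀ i, w i * Real.log (w i / p i ()) =
          w i * Real.log (w i) - w i * Real.log (p i ()) := fun i => by
        rw [Real.log_div (hw i).ne' (hp1 i).ne', mul_sub]
      simp only [this, Finset.sum_sub_distrib] at hkl'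
      linarith)
  have hg : ∀ y, lowerDualFn π ε B v z y (par ℓ) = ℓ (1, |y| ^ (1 + ε), max (y - z) 0) :=
    fun y => by rw [hfn, hℓt]; ring
  have hcg : ∀ i, c i ≤ lowerDualFn π ε B v z (x i) (par ℓ) := fun i => by
    rw [hg]; exact hce i ()
  refine ⟨par ℓ, ⟨hℓK _ hea, fun y => ?_⟩, fun i => (hc i).trans_le (hcg i), ?_⟩
  · rw [hg]; exact hℓK _ (he y)
  · have : ∀ i, w i * Real.log (w i / c i) = w i * Real.log (w i) - w i * Real.log (c i) :=
      fun i => by rw [Real.log_div (hw i).ne' (hc i).ne', mul_sub]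
    simp only [this, Finset.sum_sub_distrib] at hsum
    have hle : ∑ i, w i * Real.log (c i) ≤
        ∑ i, w i * Real.log (lowerDualFn π ε B v z (x i) (par ℓ)) :=
      Finset.sum_le_sum fun i _ =>
        mul_le_mul_of_nonneg_left (Real.log_le_log (hc i) (hcg i)) (hw i).le
    linarith

end StrongDuality

/-! ### Ville's inequality -/

section Ville

variable {Ω : Type*} {mΩ : MeasurableSpace Ω} {P : Measure Ω} {ℱ : Filtration ℕ mΩ}

/-- Ville's maximal inequality for a nonnegative supermartingale. -/
theorem mul_measure_exists_le_le {M : ℕ → Ω → ℝ≥0∞} (hM : ∀ n, Measurable[ℱ n] (M n))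
    (hstep : ∀ n D, MeasurableSet[ℱ n] D → ∫⁻ ω in D, M (n + 1) ω ∂P ≤ ∫⁻ ω in D, M n ω ∂P)
    (c : ℝ≥0∞) : c * P {ω | ∃ n, c ≤ M n ω} ≤ ∫⁻ ω, M 0 ω ∂P := by
  have hM' : ∀ n, Measurable (M n) := fun n => (hM n).mono (ℱ.le n) le_rfl
  set H : ℕ → Set Ω := fun k => {ω | c ≤ M k ω} with hH
  have hHm : ∀ k, MeasurableSet[ℱ k] (H k) := fun k => hM k measurableSet_Ici
  set A : ℕ → Set Ω := fun k => ⋃ m ∈ Finset.range (k + 1), H m with hA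
  have hAm : ∀ k, MeasurableSet[ℱ k] (A k) := fun k =>
    Finset.measurableSet_biUnion _ fun m hm =>
      ℱ.mono (Nat.lt_succ_iff.1 (Finset.mem_range.1 hm)) _ (hHm m)
  have hAsucc : ∀ k, A (k + 1) = A k ∪ (A k)ᶜ ∩ H (k + 1) := by
    intro k
    have : A (k + 1) = H (k + 1) ∪ A k := by
      simp only [hA]
      rw [Finset.range_add_one (n := k + 1), Finset.set_biUnion_insert]
    rw [this]
    ext ω
    simp only [mem_union, mem_inter_iff, mem_compl_iff]
    tauto
  have hmarkov : ∀ k D, c * P (D ∩ H k) ≤ ∫⁻ ω in D ∩ H k, M k ω ∂P := by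
    intro k D
    rw [← setLIntegral_const]
    exact setLIntegral_mono (hM' k) fun ω hω => hω.2
  -- The invariant of stopping at the first passage above `c`: the stopped part contributes at least
  -- `c` times its probability, the rest still carries `M k`.
  have key : ∀ k, c * P (A k) + ∫⁻ ω in (A k)ᶜ, M k ω ∂P ≤ ∫⁻ ω, M 0 ω ∂P := by
    intro k
    induction k with
    | zero =>
      have h0 : A 0 = univ ∩ H 0 := by simp [hA]
      have h1 : c * P (A 0) ≤ ∫⁻ ω in A 0, M 0 ω ∂P := by
        rw [h0]; exact hmarkov 0 univ
      calc c * P (A 0) + ∫⁻ ω in (A 0)ᶜ, M 0 ω ∂P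
          ≤ ∫⁻ ω in A 0, M 0 ω ∂P + ∫⁻ ω in (A 0)ᶜ, M 0 ω ∂P := by gcongr
        _ = ∫⁻ ω, M 0 ω ∂P := lintegral_add_compl (M 0) (ℱ.le _ _ (hAm 0))
    | succ k ih =>
      have hHm' := ℱ.le _ _ (hHm (k + 1))
      have hcompl : (A (k + 1))ᶜ = (A k)ᶜ \ H (k + 1) := by
        rw [hAsucc]
        ext ω
        simp only [mem_union, mem_inter_iff, mem_compl_iff, mem_sdiff]
        tauto
      calc c * P (A (k + 1)) + ∫⁻ ω in (A (k + 1))ᶜ, M (k + 1) ω ∂P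
          ≤ c * (P (A k) + P ((A k)ᶜ ∩ H (k + 1)))
            + ∫⁻ ω in (A k)ᶜ \ H (k + 1), M (k + 1) ω ∂P := by
            rw [hcompl, hAsucc]
            gcongr
            exact measure_union_le _ _
        _ ≤ c * P (A k) + (∫⁻ ω in (A k)ᶜ ∩ H (k + 1), M (k + 1) ω ∂P
            + ∫⁻ ω in (A k)ᶜ \ H (k + 1), M (k + 1) ω ∂P) := by
            rw [mul_add, add_assoc]
            gcongr
            exact hmarkov _ _
        _ = c * P (A k) + ∫⁻ ω in (A k)ᶜ, M (k + 1) ω ∂P := by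
            rw [lintegral_inter_add_sdiff _ _ hHm']
        _ ≤ c * P (A k) + ∫⁻ ω in (A k)ᶜ, M k ω ∂P := by
            gcongr 1
            exact hstep k _ (hAm k).compl
        _ ≤ _ := ih
  have hunion : {ω | ∃ n, c ≤ M n ω} = ⋃ k, A k := by
    ext ω
    simp only [hA, hH, mem_ofPred_eq, mem_iUnion, Finset.mem_range, exists_prop]
    constructor
    · rintro ⟨n, hn⟩; exact ⟨n, n, n.lt_succ_self, hn⟩
    · rintro ⟨_, n, _, hn⟩; exact ⟨n, hn⟩
  have hmono : Monotone A := monotone_nat_of_le_succ fun k => by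
    rw [hAsucc]; exact subset_union_left
  rw [hunion, hmono.measure_iUnion, ENNReal.mul_iSup]
  exact iSup_le fun k => le_self_add.trans (key k)

end Ville

/-! ### Regret of the uniform mixture -/

section Mixture

variable {Λ : Type*} [NormedAddCommGroup Λ] [NormedSpace ℝ Λ] [FiniteDimensional ℝ Λ]
  [MeasurableSpace Λ] [BorelSpace Λ] (ν : Measure Λ) [ν.IsAddHaarMeasure]

theorem exp_neg_one_le_one_sub_inv_pow (n : ℕ) :
    Real.exp (-1) ≤ (1 - ((n : ℝ) + 1)⁻¹) ^ n := by
  rcases n.eq_zero_or_pos with rfl | hn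
  · simp
  have hn' : (0 : ℝ) < n := Nat.cast_pos.2 hn
  have h1 : (1 - ((n : ℝ) + 1)⁻¹) = (1 + (n : ℝ)⁻¹)⁻¹ := by field_simp; ring
  have h2 : (1 + (n : ℝ)⁻¹) ^ n ≤ Real.exp 1 := by
    calc (1 + (n : ℝ)⁻¹) ^ n ≤ Real.exp ((n : ℝ)⁻¹) ^ n := by
          gcongr
          linarith [Real.add_one_le_exp (n : ℝ)⁻¹]
      _ = Real.exp 1 := by rw [← Real.exp_nat_mul, mul_inv_cancel₀ hn'.ne']
  rw [h1, inv_pow, Real.exp_neg]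
  exact inv_anti₀ (by positivity) h2

/-- The regret of the uniform mixture for products of concave functions. -/
theorem prod_mul_measure_le_mixture {S : Set Λ} (hS : Convex ℝ S) {g : ℕ → Λ → ℝ}
    (hgm : ∀ t, Measurable (g t)) (hgc : ∀ t, ConcaveOn ℝ S (g t))
    (hg0 : ∀ t, ∀ l ∈ S, 0 ≤ g t l) (n : ℕ) {l : Λ} (hl : l ∈ S) :
    ENNReal.ofReal (∏ t ∈ Finset.range n, g t l) * ν S ≤
      ENNReal.ofReal (Real.exp 1 * ((n : ℝ) + 1) ^ Module.finrank ℝ Λ) *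
        ∫⁻ l' in S, ∏ t ∈ Finset.range n, ENNReal.ofReal (g t l') ∂ν := by
  set d := Module.finrank ℝ Λ
  -- The homothety of ratio `s` centred at `l` scales volume by `s ^ d`, while concavity and
  -- nonnegativity keep each factor at least `(1 - s) g t l` on the image. With `s = 1/(n+1)` the
  -- total loss `(1 - s) ^ n` is at least `1/e`.
  set s : ℝ := ((n : ℝ) + 1)⁻¹ with hs
  have hs0 : 0 < s := by positivity
  have hs1 : s ≤ 1 := inv_le_one_of_one_le₀ (by simp)
  have hexp := exp_neg_one_le_one_sub_inv_pow n
  set p := ∏ t ∈ Finset.range n, g t l with hp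
  have hp0 : 0 ≤ p := Finset.prod_nonneg fun t _ => hg0 t l hl
  have hpt : ∀ x ∈ S, AffineMap.homothety l s x ∈ S ∧
      ∀ t, (1 - s) * g t l ≤ g t (AffineMap.homothety l s x) := by
    intro x hx
    have hxe : AffineMap.homothety l s x = (1 - s) • l + s • x := by
      simp [AffineMap.homothety_apply, smul_sub, sub_smul]; abel
    rw [hxe]
    refine ⟨hS hl hx (by linarith) hs0.le (by ring), fun t => ?_⟩
    have h1 := (hgc t).2 hl hx (show 0 ≤ 1 - s by linarith) hs0.le (by ring)
    have h2 := mul_nonneg hs0.le (hg0 t x hx)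
    simp only [smul_eq_mul] at h1
    linarith
  have hsub : AffineMap.homothety l s '' S ⊆ S := by
    rintro _ ⟨x, hx, rfl⟩; exact (hpt x hx).1
  have hlow : ENNReal.ofReal (Real.exp (-1) * p) * (ENNReal.ofReal (s ^ d) * ν S) ≤
      ∫⁻ l' in S, ∏ t ∈ Finset.range n, ENNReal.ofReal (g t l') ∂ν := by
    have hvol : ν (AffineMap.homothety l s '' S) = ENNReal.ofReal (s ^ d) * ν S := by
      rw [Measure.addHaar_image_homothety, abs_of_nonneg (by positivity)]
    rw [← hvol, ← setLIntegral_const]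
    refine le_trans (setLIntegral_mono (by fun_prop) ?_) (lintegral_mono_set hsub)
    rintro _ ⟨x, hx, rfl⟩
    rw [← ENNReal.ofReal_prod_of_nonneg fun t _ => hg0 t _ (hpt x hx).1]
    refine ENNReal.ofReal_le_ofReal ?_
    calc Real.exp (-1) * p ≤ (1 - s) ^ n * p := by gcongr
      _ = ∏ t ∈ Finset.range n, (1 - s) * g t l := by
        rw [Finset.prod_mul_distrib, Finset.prod_const, Finset.card_range]
      _ ≤ _ := Finset.prod_le_prod (fun t _ => mul_nonneg (by linarith) (hg0 t l hl))
        fun t _ => (hpt x hx).2 t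
  refine le_trans (le_of_eq ?_) (mul_le_mul_right hlow _)
  rw [← mul_assoc, ← mul_assoc, ← ENNReal.ofReal_mul (by positivity),
    ← ENNReal.ofReal_mul (by positivity)]
  congr 2
  rw [Real.exp_neg, hs, inv_pow]
  field_simp

end Mixture

/-! ### Supermartingales along adaptive sampling -/

section Sampling

theorem measurable_prod_sample {Ω Λ : Type*} {m : MeasurableSpace Ω} [MeasurableSpace Λ] {K : ℕ}
    {A : ℕ → Ω → Fin K} {X : ℕ → Ω → ℝ} {G : Fin K → ℝ → Λ → ℝ}
    (hG : ∀ a, Measurable (Function.uncurry (G a))) {n : ℕ}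
    (hA : ∀ t < n, Measurable (A t)) (hX : ∀ t < n, Measurable (X t)) :
    Measurable fun q : Ω × Λ =>
      ∏ t ∈ Finset.range n, ENNReal.ofReal (G (A t q.1) (X t q.1) q.2) := by
  refine Finset.measurable_fun_prod _ fun t ht => ENNReal.measurable_ofReal.comp ?_
  have ht := Finset.mem_range.1 ht
  exact (measurable_from_prod_countable_right
    (f := fun p : Fin K × ℝ × Λ => G p.1 p.2.1 p.2.2) hG).comp
      (((hA t ht).comp measurable_fst).prodMk
        (((hX t ht).comp measurable_fst).prodMk measurable_snd))

variable {Ω : Type*} {mΩ : MeasurableSpace Ω} {P : Measure Ω} [IsProbabilityMeasure P]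
  {K : ℕ} {μ : Fin K → Measure ℝ} {ℱ : Filtration ℕ mΩ} {A : ℕ → Ω → Fin K} {X : ℕ → Ω → ℝ}

theorem IsBanditProcess.map_restrict (hAX : IsBanditProcess μ P ℱ A X)
    (hμ : ∀ a, IsProbabilityMeasure (μ a)) (n : ℕ) (a : Fin K) {D : Set Ω}
    (hD : MeasurableSet[ℱ n] D) (hDa : ∀ ω ∈ D, A n ω = a) :
    (P.restrict D).map (X n) = P D • μ a := by
  have hXm : Measurable (X n) := (hAX.measurable_sample n).mono (ℱ.le _) le_rfl
  have hD' := ℱ.le n _ hD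
  ext s hs
  rw [Measure.map_apply hXm hs, Measure.restrict_apply (hXm hs), Measure.smul_apply, smul_eq_mul]
  have hint : Integrable ((X n ⁻¹' s).indicator fun _ => (1 : ℝ)) P :=
    (integrable_const 1).indicator (hXm hs)
  have h1 := setIntegral_condExp (ℱ.le n) hint hD
  have h2 : ∫ ω in D, (P⟦X n ⁻¹' s | ℱ n⟧) ω ∂P = ∫ _ in D, (μ a).real s ∂P := by
    refine setIntegral_congr_ae hD' ?_
    filter_upwards [hAX.condDistrib_sample n s hs] with ω hω hωD
    rw [hω, hDa ω hωD]
  rw [h2, setIntegral_const, integral_indicator_const _ (hXm hs), smul_eq_mul, smul_eq_mul,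
    mul_one, measureReal_restrict_apply (hXm hs)] at h1
  rw [← ENNReal.toReal_eq_toReal_iff' (measure_ne_top _ _)
    (ENNReal.mul_ne_top (measure_ne_top _ _) (measure_ne_top _ _)), ENNReal.toReal_mul]
  exact h1.symm

/-- One step of the supermartingale property. On `ℱ n`, the measure with density `φ (A n) (X n)` is
dominated by `P`: split an event according to the chosen arm, on which the new sample has a known
law and the e-value has mean at most `1`. -/
theorem IsBanditProcess.lintegral_mul_sample_le (hAX : IsBanditProcess μ P ℱ A X)
    (hμ : ∀ a, IsProbabilityMeasure (μ a)) {φ : Fin K → ℝ → ℝ≥0∞} (hφ : ∀ a, Measurable (φ a))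
    (hφ1 : ∀ a, ∫⁻ y, φ a y ∂μ a ≤ 1) (n : ℕ) {Z : Ω → ℝ≥0∞} (hZ : Measurable[ℱ n] Z) :
    ∫⁻ ω, Z ω * φ (A n ω) (X n ω) ∂P ≤ ∫⁻ ω, Z ω ∂P := by
  have hXm : Measurable (X n) := (hAX.measurable_sample n).mono (ℱ.le _) le_rfl
  have hAm : Measurable (A n) := (hAX.measurable_arm n).mono (ℱ.le _) le_rfl
  have hφm : Measurable fun ω => φ (A n ω) (X n ω) :=
    (measurable_from_prod_countable_right (f := fun p : Fin K × ℝ => φ p.1 p.2) hφ).comp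
      (hAm.prodMk hXm)
  have hle : (P.withDensity fun ω => φ (A n ω) (X n ω)).trim (ℱ.le n) ≤ P.trim (ℱ.le n) := by
    refine Measure.le_iff.2 fun D hD => ?_
    have hD' := ℱ.le n _ hD
    rw [trim_measurableSet_eq _ hD, trim_measurableSet_eq _ hD, withDensity_apply _ hD']
    have hfib : ∀ a, MeasurableSet[ℱ n] (D ∩ A n ⁻¹' {a}) := fun a =>
      hD.inter (hAX.measurable_arm n (measurableSet_singleton a))
    have hdisj : Pairwise (Function.onFun Disjoint fun a => D ∩ A n ⁻¹' {a}) := by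
      intro a b hab
      refine Set.disjoint_left.2 fun ω ha hb => hab ?_
      rw [← show A n ω = a from ha.2, ← show A n ω = b from hb.2]
    have hUn : D = ⋃ a, D ∩ A n ⁻¹' {a} := by ext ω; simp
    calc ∫⁻ ω in D, φ (A n ω) (X n ω) ∂P
        = ∑ a, ∫⁻ ω in D ∩ A n ⁻¹' {a}, φ (A n ω) (X n ω) ∂P := by
          conv_lhs => rw [hUn]
          rw [lintegral_iUnion (fun a => ℱ.le n _ (hfib a)) hdisj, tsum_fintype]
      _ = ∑ a, P (D ∩ A n ⁻¹' {a}) * ∫⁻ y, φ a y ∂μ a := by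
          refine Finset.sum_congr rfl fun a _ => ?_
          rw [← smul_eq_mul, ← lintegral_smul_measure,
            ← hAX.map_restrict hμ n a (hfib a) (fun ω hω => hω.2), lintegral_map (hφ a) hXm]
          exact setLIntegral_congr_fun (ℱ.le n _ (hfib a)) fun ω hω => by
            rw [show A n ω = a from hω.2]
      _ ≤ ∑ a, P (D ∩ A n ⁻¹' {a}) * 1 := by gcongr with a; exact hφ1 a
      _ = P D := by
          conv_rhs => rw [hUn, measure_iUnion hdisj fun a => ℱ.le n _ (hfib a), tsum_fintype]
          simp
  calc ∫⁻ ω, Z ω * φ (A n ω) (X n ω) ∂P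
      = ∫⁻ ω, Z ω ∂(P.withDensity fun ω => φ (A n ω) (X n ω)) := by
        rw [lintegral_withDensity_eq_lintegral_mul _ hφm (hZ.mono (ℱ.le n) le_rfl)]
        exact lintegral_congr fun ω => mul_comm _ _
    _ ≤ ∫⁻ ω, Z ω ∂P := by
        rw [← lintegral_trim (ℱ.le n) hZ, ← lintegral_trim (ℱ.le n) hZ]
        exact lintegral_mono' hle le_rfl

variable {Λ : Type*} [NormedAddCommGroup Λ] [NormedSpace ℝ Λ] [FiniteDimensional ℝ Λ]
  [MeasurableSpace Λ] [BorelSpace Λ] {G : Fin K → ℝ → Λ → ℝ} {S : Set Λ}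

/-- A time-uniform bound on products of concave families of e-values along the samples, over a
bounded parameter set. -/
theorem IsBanditProcess.measure_exists_prod_le_of_bounded (hAX : IsBanditProcess μ P ℱ A X)
    (hμ : ∀ a, IsProbabilityMeasure (μ a)) (hG : ∀ a, Measurable (Function.uncurry (G a)))
    (hS : Convex ℝ S) (hSi : (interior S).Nonempty) (hSb : Bornology.IsBounded S)
    (hGc : ∀ a y, ConcaveOn ℝ S (G a y))
    (hG0 : ∀ a y, ∀ l ∈ S, 0 ≤ G a y l)
    (hG1 : ∀ a, ∀ l ∈ S, ∫⁻ y, ENNReal.ofReal (G a y l) ∂μ a ≤ 1) {c : ℝ} (hc : 0 < c) :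
    P {ω | ∃ n : ℕ, ∃ l ∈ S, c * (Real.exp 1 * ((n : ℝ) + 1) ^ Module.finrank ℝ Λ) ≤
      ∏ t ∈ Finset.range n, G (A t ω) (X t ω) l} ≤ ENNReal.ofReal c⁻¹ := by
  set ν : Measure Λ := Measure.addHaar with hν
  have hν0 : ν S ≠ 0 := fun h =>
    (isOpen_interior.measure_pos ν hSi).ne' (measure_mono_null interior_subset h)
  have hνt : ν S ≠ ∞ := hSb.measure_lt_top.ne
  have hAm : ∀ t, Measurable (A t) := fun t => (hAX.measurable_arm t).mono (ℱ.le _) le_rfl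
  have hXm : ∀ t, Measurable (X t) := fun t => (hAX.measurable_sample t).mono (ℱ.le _) le_rfl
  have hmeas : ∀ n, Measurable[(ℱ n).prod inferInstance] fun q : Ω × Λ =>
      ∏ t ∈ Finset.range n, ENNReal.ofReal (G (A t q.1) (X t q.1) q.2) := fun n =>
    measurable_prod_sample (m := ℱ n) hG
      (fun t ht => (hAX.measurable_arm t).mono (ℱ.mono ht.le) le_rfl)
      (fun t ht => (hAX.measurable_sample t).mono (ℱ.mono ht) le_rfl)
  have hmeas' : ∀ n, Measurable fun q : Ω × Λ =>
      ∏ t ∈ Finset.range n, ENNReal.ofReal (G (A t q.1) (X t q.1) q.2) := fun n =>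
    measurable_prod_sample hG (fun t _ => hAm t) (fun t _ => hXm t)
  set M : ℕ → Ω → ℝ≥0∞ := fun n ω =>
    ∫⁻ l in S, ∏ t ∈ Finset.range n, ENNReal.ofReal (G (A t ω) (X t ω) l) ∂ν with hM
  have hMm : ∀ n, Measurable[ℱ n] (M n) := fun n =>
    @Measurable.lintegral_prod_right' Ω Λ (ℱ n) _ (ν.restrict S) _ _ (hmeas n)
  have hstep : ∀ n D, MeasurableSet[ℱ n] D →
      ∫⁻ ω in D, M (n + 1) ω ∂P ≤ ∫⁻ ω in D, M n ω ∂P := by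
    intro n D hD
    have hD' := ℱ.le n _ hD
    have hswap : ∀ n, ∫⁻ ω in D, M n ω ∂P = ∫⁻ l in S, ∫⁻ ω in D,
        ∏ t ∈ Finset.range n, ENNReal.ofReal (G (A t ω) (X t ω) l) ∂P ∂ν := fun n =>
      lintegral_lintegral_swap (hmeas' n).aemeasurable
    rw [hswap, hswap]
    refine lintegral_mono_ae ?_
    -- Convexity makes `S` null-measurable, so its measurability need not be shown.
    filter_upwards [ae_restrict_mem₀ (hS.nullMeasurableSet (μ := ν))] with l hl
    simp only [Finset.prod_range_succ]
    have hZ : Measurable[ℱ n] fun ω =>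
        ∏ t ∈ Finset.range n, ENNReal.ofReal (G (A t ω) (X t ω) l) :=
      (hmeas n).comp (@measurable_prodMk_right Ω Λ (ℱ n) _ l)
    have h := hAX.lintegral_mul_sample_le hμ (φ := fun a y => ENNReal.ofReal (G a y l))
      (fun a => ((hG a).comp measurable_prodMk_right).ennreal_ofReal) (fun a => hG1 a l hl) n
      (hZ.indicator hD)
    rw [← lintegral_indicator hD', ← lintegral_indicator hD']
    refine le_trans (le_of_eq (lintegral_congr fun ω => ?_)) h
    by_cases hω : ω ∈ D <;> simp [hω]
  have hville := mul_measure_exists_le_le hMm hstep (ENNReal.ofReal c * ν S)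
  have hM0 : ∫⁻ ω, M 0 ω ∂P = ν S := by simp [hM]
  rw [hM0] at hville
  have hsub : {ω | ∃ n : ℕ, ∃ l ∈ S, c * (Real.exp 1 * ((n : ℝ) + 1) ^ Module.finrank ℝ Λ) ≤
      ∏ t ∈ Finset.range n, G (A t ω) (X t ω) l} ⊆ {ω | ∃ n, ENNReal.ofReal c * ν S ≤ M n ω} := by
    rintro ω ⟨n, l, hl, hle⟩
    refine ⟨n, ?_⟩
    have h1 := prod_mul_measure_le_mixture ν hS (g := fun t => G (A t ω) (X t ω))
      (fun t => (hG _).comp measurable_prodMk_left) (fun t => hGc _ _) (fun t => hG0 _ _) n hl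
    have h2 := (mul_le_mul_left (ENNReal.ofReal_le_ofReal hle) (ν S)).trans h1
    rw [ENNReal.ofReal_mul hc.le, mul_comm (ENNReal.ofReal c), mul_assoc] at h2
    exact (ENNReal.mul_le_mul_iff_right (ENNReal.ofReal_pos.2 (by positivity)).ne'
      ENNReal.ofReal_ne_top).1 h2
  refine (measure_mono hsub).trans ?_
  rw [mul_right_comm] at hville
  have h3 : ENNReal.ofReal c * P {ω | ∃ n, ENNReal.ofReal c * ν S ≤ M n ω} ≤ 1 := by
    rw [← ENNReal.mul_le_mul_iff_left hν0 hνt, one_mul]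
    exact hville
  rw [ENNReal.ofReal_inv_of_pos hc, ENNReal.le_inv_iff_mul_le, mul_comm]
  exact h3

/-- A time-uniform bound on products of concave families of e-values along the samples. -/
theorem IsBanditProcess.measure_exists_prod_le (hAX : IsBanditProcess μ P ℱ A X)
    (hμ : ∀ a, IsProbabilityMeasure (μ a)) (hG : ∀ a, Measurable (Function.uncurry (G a)))
    (hS : Convex ℝ S) (hSi : (interior S ∩ Metric.ball 0 1).Nonempty)
    (hGc : ∀ a y, ConcaveOn ℝ S (G a y))
    (hG0 : ∀ a y, ∀ l ∈ S, 0 ≤ G a y l)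
    (hG1 : ∀ a, ∀ l ∈ S, ∫⁻ y, ENNReal.ofReal (G a y l) ∂μ a ≤ 1) {c : ℝ} (hc : 0 < c) :
    P {ω | ∃ n : ℕ, ∃ l ∈ S, c * (Real.exp 1 * ((n : ℝ) + 1) ^ Module.finrank ℝ Λ) ≤
      ∏ t ∈ Finset.range n, G (A t ω) (X t ω) l} ≤ ENNReal.ofReal c⁻¹ := by
  -- The bound for a bounded set depends only on the dimension, so it passes to the limit along the
  -- increasing traces of `S` on balls.
  set V : ℕ → Set Ω := fun k => {ω | ∃ n : ℕ, ∃ l ∈ S ∩ Metric.ball 0 ((k : ℝ) + 1),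
    c * (Real.exp 1 * ((n : ℝ) + 1) ^ Module.finrank ℝ Λ) ≤
      ∏ t ∈ Finset.range n, G (A t ω) (X t ω) l} with hV
  have hmono : Monotone V := by
    rintro k k' hk ω ⟨n, l, ⟨hl, hlb⟩, hle⟩
    refine ⟨n, l, ⟨hl, Metric.ball_subset_ball ?_ hlb⟩, hle⟩
    have : (k : ℝ) ≤ k' := Nat.cast_le.2 hk
    linarith
  have hunion : {ω | ∃ n : ℕ, ∃ l ∈ S, c * (Real.exp 1 * ((n : ℝ) + 1) ^ Module.finrank ℝ Λ) ≤
      ∏ t ∈ Finset.range n, G (A t ω) (X t ω) l} ⊆ ⋃ k, V k := by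
    rintro ω ⟨n, l, hl, hle⟩
    obtain ⟨k, hk⟩ := exists_nat_gt ‖l‖
    exact mem_iUnion.2 ⟨k, n, l, ⟨hl, mem_ball_zero_iff.2 (by linarith)⟩, hle⟩
  refine (measure_mono hunion).trans ?_
  rw [hmono.measure_iUnion]
  refine iSup_le fun k => ?_
  have hconv := hS.inter (convex_ball (0 : Λ) ((k : ℝ) + 1))
  refine hAX.measure_exists_prod_le_of_bounded hμ hG hconv ?_
    (Metric.isBounded_ball.subset inter_subset_right)
    (fun a y => (hGc a y).subset inter_subset_left hconv)
    (fun a y l hl => hG0 a y l hl.1) (fun a l hl => hG1 a l hl.1) hc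
  rw [interior_inter, Metric.isOpen_ball.interior_eq]
  exact hSi.mono (inter_subset_inter_right _ (Metric.ball_subset_ball (by simp)))

end Sampling

theorem mul_le_abs_of_le_one {p a : ℝ} (hp0 : 0 ≤ p) (hp1 : p ≤ 1) : p * a ≤ |a| :=
  (mul_le_mul_of_nonneg_left (le_abs_self a) hp0).trans
    (mul_le_of_le_one_left (abs_nonneg a) hp1)

/-! ### Concavity, convexity and interior of the parameter sets -/

section DualSets

variable {π ε B v z : ℝ}

theorem concaveOn_upperDualFn (y : ℝ) : ConcaveOn ℝ univ (upperDualFn π ε B v y) := by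
  refine ⟨convex_univ, fun l _ l' _ a b ha hb hab => ?_⟩
  have h1 : a * min 0 (l.1 + l.2.1 * y) + b * min 0 (l'.1 + l'.2.1 * y) ≤
      min 0 ((a * l.1 + b * l'.1) + (a * l.2.1 + b * l'.2.1) * y) := by
    have := mul_le_mul_of_nonneg_left (min_le_left 0 (l.1 + l.2.1 * y)) ha
    have := mul_le_mul_of_nonneg_left (min_le_right 0 (l.1 + l.2.1 * y)) ha
    have := mul_le_mul_of_nonneg_left (min_le_left 0 (l'.1 + l'.2.1 * y)) hb
    have := mul_le_mul_of_nonneg_left (min_le_right 0 (l'.1 + l'.2.1 * y)) hb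
    refine le_min ?_ ?_ <;> linarith
  simp only [upperDualFn, smul_eq_mul, Prod.fst_add, Prod.snd_add, Prod.smul_fst, Prod.smul_snd]
  obtain rfl : b = 1 - a := by linarith
  linarith

theorem concaveOn_lowerDualFn (y : ℝ) : ConcaveOn ℝ univ (lowerDualFn π ε B v z y) := by
  refine ⟨convex_univ, fun l _ l' _ a b ha hb hab => le_of_eq ?_⟩
  simp only [lowerDualFn, smul_eq_mul, Prod.fst_add, Prod.snd_add, Prod.smul_fst, Prod.smul_snd]
  obtain rfl : b = 1 - a := by linarith
  ring

theorem convex_upperDualSet : Convex ℝ (upperDualSet π ε B v) := by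
  rintro l ⟨hl, hlg⟩ l' ⟨hl', hlg'⟩ a b ha hb hab
  refine ⟨add_nonneg (mul_nonneg ha hl) (mul_nonneg hb hl'), fun y => ?_⟩
  exact (add_nonneg (mul_nonneg ha (hlg y)) (mul_nonneg hb (hlg' y))).trans
    ((concaveOn_upperDualFn y).2 trivial trivial ha hb hab)

theorem convex_lowerDualSet : Convex ℝ (lowerDualSet π ε B v z) := by
  rintro l ⟨hl, hlg⟩ l' ⟨hl', hlg'⟩ a b ha hb hab
  refine ⟨add_nonneg (mul_nonneg ha hl) (mul_nonneg hb hl'), fun y => ?_⟩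
  exact (add_nonneg (mul_nonneg ha (hlg y)) (mul_nonneg hb (hlg' y))).trans
    ((concaveOn_lowerDualFn y).2 trivial trivial ha hb hab)

theorem interior_upperDualSet_inter_ball_nonempty (hπ : π ∈ Ioo (0 : ℝ) 1) (hε : 0 < ε)
    (hB : 0 ≤ B) : (interior (upperDualSet π ε B v) ∩ Metric.ball 0 1).Nonempty := by
  -- The condition `|β| < γ` lets the moment term absorb `β y`, through `|y| ≤ 1 + |y| ^ (1 + ε)`;
  -- the second condition keeps the remaining terms below `1`.
  set O : Set (ℝ × ℝ × ℝ) :=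
    {l | |l.2.1| < l.2.2} ∩ {l | l.2.2 * B + |l.1| + |l.2.1| * (1 + |v|) < 1} with hO
  have hOo : IsOpen O := (isOpen_lt (by fun_prop) (by fun_prop)).inter
    (isOpen_lt (by fun_prop) (by fun_prop))
  have hsub : O ⊆ upperDualSet π ε B v := by
    rintro ⟨θ, β, γ⟩ ⟨h1, h2⟩
    simp only [mem_ofPred_eq] at h1 h2
    have hγ : 0 ≤ γ := (abs_nonneg β).trans h1.le
    refine ⟨hγ, fun y => ?_⟩
    have hf : 0 ≤ |y| ^ (1 + ε) := Real.rpow_nonneg (abs_nonneg y) _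
    have hy := abs_le_one_add_rpow hε y
    have hβv : |β * v| = |β| * |v| := abs_mul _ _
    have hβy : |β * y| = |β| * |y| := abs_mul _ _
    have e1 := mul_nonneg (sub_nonneg.2 h1.le) hf
    have e2 := mul_le_mul_of_nonneg_left hy (abs_nonneg β)
    have e3 := mul_nonneg hγ hf
    have e4 := neg_abs_le (β * y)
    have hπ0 : 0 ≤ 1 - π := by linarith [hπ.2]
    have hπ1 : 1 - π ≤ 1 := by linarith [hπ.1]
    have e5 := mul_le_abs_of_le_one (a := θ) hπ0 hπ1
    have e6 := mul_le_abs_of_le_one (a := -θ) hπ.1.le hπ.2.le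
    have e7 := mul_le_abs_of_le_one (a := β * v) hπ0 hπ1
    rw [abs_neg] at e6
    have e8 := abs_nonneg β
    simp only [upperDualFn]
    rcases le_total 0 (θ + β * y) with h | h
    · rw [min_eq_left h]; linarith
    · rw [min_eq_right h]; linarith
  have hγ : 0 < (B + 2)⁻¹ := by positivity
  have hγ1 : (B + 2)⁻¹ * (B + 2) = 1 := inv_mul_cancel₀ (by linarith)
  have hγ2 : (B + 2)⁻¹ < 1 := inv_lt_one_of_one_lt₀ (by linarith)
  refine ⟨(0, 0, (B + 2)⁻¹), interior_maximal hsub hOo ⟨?_, ?_⟩, ?_⟩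
  · simpa using hγ
  · simp only [mem_ofPred_eq, abs_zero]; linarith
  · simp only [mem_ball_zero_iff, Prod.norm_mk, norm_zero, Real.norm_eq_abs, abs_of_pos hγ]
    simp [hγ2]

theorem interior_lowerDualSet_inter_ball_nonempty (hπ : π ∈ Ioo (0 : ℝ) 1)
    (hB : 0 ≤ B) : (interior (lowerDualSet π ε B v z) ∩ Metric.ball 0 1).Nonempty := by
  set O : Set (ℝ × ℝ) :=
    {l | 0 < l.1} ∩ ({l | 0 < l.2} ∩ {l | l.2 * B + l.1 * |v - z| < 1}) with hO
  have hOo : IsOpen O := (isOpen_lt (by fun_prop) (by fun_prop)).inter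
    ((isOpen_lt (by fun_prop) (by fun_prop)).inter (isOpen_lt (by fun_prop) (by fun_prop)))
  have hsub : O ⊆ lowerDualSet π ε B v z := by
    rintro ⟨β, γ⟩ ⟨h1, h2, h3⟩
    simp only [mem_ofPred_eq] at h1 h2 h3
    refine ⟨h2.le, fun y => ?_⟩
    have e1 := mul_nonneg h2.le (Real.rpow_nonneg (abs_nonneg y) (1 + ε))
    have e2 := mul_nonneg h1.le (le_max_right (y - z) 0)
    have e3 := mul_le_abs_of_le_one (p := 1 - π) (a := v - z) (by linarith [hπ.2])
      (by linarith [hπ.1])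
    have e4 := mul_le_mul_of_nonneg_left e3 h1.le
    simp only [lowerDualFn]
    linarith
  set γ := (B + |v - z| + 2)⁻¹ with hγd
  have hb : 0 < B + |v - z| + 2 := by positivity
  have hγ : 0 < γ := inv_pos.2 hb
  have hγ1 : γ * (B + |v - z| + 2) = 1 := inv_mul_cancel₀ hb.ne'
  have hγ2 : γ < 1 := inv_lt_one_of_one_lt₀ (by linarith [abs_nonneg (v - z)])
  refine ⟨(γ, γ), interior_maximal hsub hOo ⟨hγ, hγ, ?_⟩, ?_⟩
  · simp only [mem_ofPred_eq]; linarith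
  · simp [Prod.norm_mk, abs_of_pos hγ, hγ2]

theorem lintegral_upperDualFn_le {η : Measure ℝ} (hπ : π ∈ Ioo (0 : ℝ) 1) (hε : 0 < ε)
    (hB : 0 ≤ B) (h : η ∈ momentClass ε B) {l : ℝ × ℝ × ℝ}
    (hl : l ∈ upperDualSet π ε B (condValueAtRisk π η)) :
    ∫⁻ y, ENNReal.ofReal (upperDualFn π ε B (condValueAtRisk π η) y l) ∂η ≤ 1 := by
  rw [← ofReal_integral_eq_lintegral_ofReal (integrable_upperDualFn hε h _ l) (ae_of_all _ hl.2)]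
  exact ENNReal.ofReal_le_one.2 (integral_upperDualFn_le hπ hε hB h hl.1)

theorem lintegral_lowerDualFn_le {η : Measure ℝ} (hπ : π ∈ Ioo (0 : ℝ) 1) (hε : 0 < ε)
    (hB : 0 ≤ B) (h : η ∈ momentClass ε B) {l : ℝ × ℝ}
    (hl : l ∈ lowerDualSet π ε B (condValueAtRisk π η) (valueAtRisk π η)) :
    ∫⁻ y, ENNReal.ofReal (lowerDualFn π ε B (condValueAtRisk π η) (valueAtRisk π η) y l) ∂η
      ≤ 1 := by
  rw [← ofReal_integral_eq_lintegral_ofReal (integrable_lowerDualFn hε h _ _ l)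
    (ae_of_all _ hl.2)]
  exact ENNReal.ofReal_le_one.2 (integral_lowerDualFn_le hπ hε hB h hl.1)

theorem continuous_uncurry_upperDualFn (hε : 0 < ε) :
    Continuous (Function.uncurry (upperDualFn π ε B v)) := by
  have h : Continuous fun q : ℝ × ℝ × ℝ × ℝ => |q.1| ^ (1 + ε) :=
    (continuous_abs_rpow hε).comp continuous_fst
  unfold Function.uncurry upperDualFn
  fun_prop

theorem continuous_uncurry_lowerDualFn (hε : 0 < ε) :
    Continuous (Function.uncurry (lowerDualFn π ε B v z)) := by
  have h : Continuous fun q : ℝ × ℝ × ℝ => |q.1| ^ (1 + ε) :=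
    (continuous_abs_rpow hε).comp continuous_fst
  unfold Function.uncurry lowerDualFn
  fun_prop

end DualSets

/-! ### From empirical divergences to products of e-values -/

section EmpiricalMeasure

/-- The empirical measure of a nonempty finite family of points, with repeated points collected. -/
theorem exists_empirical_eq_discreteMeasure {T : Finset ℕ} (hT : T.Nonempty) (X : ℕ → ℝ) :
    ∃ w : T.image X → ℝ, (∀ y, 0 < w y) ∧ ∑ y, w y = 1 ∧
      (T.card : ℝ≥0∞)⁻¹ • ∑ t ∈ T, Measure.dirac (X t) =
        discreteMeasure w (fun y => (y : ℝ)) ∧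
      ∀ F : ℝ → ℝ, ∑ t ∈ T, F (X t) = T.card * ∑ y : T.image X, w y * F y := by
  classical
  have hN : (0 : ℝ) < T.card := Nat.cast_pos.2 hT.card_pos
  set k : ℝ → ℕ := fun y => (T.filter fun t => X t = y).card with hk
  have hsum : ∀ F : ℝ → ℝ, ∑ t ∈ T, F (X t) =
      T.card * ∑ y : T.image X, (k y / T.card : ℝ) * F y := by
    intro F
    rw [Finset.sum_comp F X, Finset.sum_coe_sort (T.image X) fun y => (k y / T.card : ℝ) * F y,
      Finset.mul_sum]
    refine Finset.sum_congr rfl fun y _ => ?_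
    rw [nsmul_eq_mul]
    rw [← mul_assoc, mul_div_cancel₀ _ hN.ne']
  refine ⟨fun y => k y / T.card, fun y => ?_, ?_, ?_, hsum⟩
  · obtain ⟨t, ht, hty⟩ := Finset.mem_image.1 y.2
    exact div_pos (Nat.cast_pos.2 (Finset.card_pos.2 ⟨t, Finset.mem_filter.2 ⟨ht, hty⟩⟩)) hN
  · have h := hsum fun _ => 1
    simp only [Finset.sum_const, nsmul_eq_mul, mul_one] at h
    exact (mul_eq_left₀ hN.ne').1 h.symm
  · rw [Finset.sum_comp (fun y => Measure.dirac y) X, Finset.smul_sum, discreteMeasure,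
      Finset.sum_coe_sort (T.image X)
        fun y => ENNReal.ofReal (k y / T.card : ℝ) • (Measure.dirac y : Measure ℝ)]
    refine Finset.sum_congr rfl fun y _ => ?_
    rw [ENNReal.ofReal_div_of_pos hN, ENNReal.ofReal_natCast, ENNReal.ofReal_natCast,
      ← Nat.cast_smul_eq_nsmul ℝ≥0∞, smul_smul, ENNReal.div_eq_inv_mul]

/-- The sum of `log g` over the samples is the sample count times its empirical mean, so a
certificate for the empirical measure bounds the product. Collecting repeated samples makes the
support injectively indexed, as duality requires. -/
theorem exists_exp_le_prod {Λ : Type*} {I : Measure ℝ → ℝ≥0∞} {g : ℝ → Λ → ℝ} {S : Set Λ}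
    (h : ∀ (s : Finset ℝ) (w : s → ℝ), (∀ y, 0 < w y) → ∑ y, w y = 1 → ∀ D : ℝ, 0 ≤ D →
      ENNReal.ofReal D < I (discreteMeasure w fun y => (y : ℝ)) →
      ∃ l ∈ S, (∀ y : s, 0 < g y l) ∧ D < ∑ y : s, w y * Real.log (g y l))
    (h1 : ∃ l ∈ S, ∀ y, g y l = 1) (T : Finset ℕ) (X : ℕ → ℝ) {D : ℝ}
    (hD : D < 0 ∨
      ENNReal.ofReal D < T.card * I ((T.card : ℝ≥0∞)⁻¹ • ∑ t ∈ T, Measure.dirac (X t))) :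
    ∃ l ∈ S, Real.exp D ≤ ∏ t ∈ T, g (X t) l := by
  -- For negative `D` no certificate is needed: the parameter with `g = 1` gives product `1`. This
  -- also covers an arm without samples.
  rcases lt_or_ge D 0 with hD0 | hD0
  · obtain ⟨l, hl, hl1⟩ := h1
    exact ⟨l, hl, by simpa [hl1] using hD0.le⟩
  replace hD := hD.resolve_left (not_lt.2 hD0)
  rcases T.eq_empty_or_nonempty with rfl | hT
  · simp at hD
  have hN : (0 : ℝ) < T.card := Nat.cast_pos.2 hT.card_pos
  obtain ⟨w, hw, hw1, hη, hsum⟩ := exists_empirical_eq_discreteMeasure hT X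
  rw [hη] at hD
  have hD' : ENNReal.ofReal (D / T.card) < I (discreteMeasure w fun y => (y : ℝ)) := by
    rw [ENNReal.ofReal_div_of_pos hN, ENNReal.ofReal_natCast]
    refine (ENNReal.div_lt_iff (Or.inl ?_) (Or.inl (ENNReal.natCast_ne_top _))).2 ?_
    · exact_mod_cast hT.card_ne_zero
    · rwa [mul_comm] at hD
  obtain ⟨l, hl, hpos, hlt⟩ := h _ w hw hw1 _ (div_nonneg hD0 hN.le) hD'
  refine ⟨l, hl, ?_⟩
  have hposT : ∀ t ∈ T, 0 < g (X t) l := fun t ht => hpos ⟨X t, Finset.mem_image_of_mem X ht⟩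
  rw [← Finset.prod_congr rfl fun t ht => Real.exp_log (hposT t ht), ← Real.exp_sum,
    Real.exp_le_exp, hsum fun y => Real.log (g y l)]
  rw [div_lt_iff₀ hN] at hlt
  linarith

/-- Certificates exist only strictly below each infimum, so each finite summand gives up `1/2`. If a
summand is infinite, it takes all of `s` and the other gets `-1`. -/
theorem ENNReal.exists_real_lt_of_ofReal_le_add {a b : ℝ≥0∞} {s : ℝ}
    (h : ENNReal.ofReal s ≤ a + b) :
    ∃ D D' : ℝ, (D < 0 ∨ ENNReal.ofReal D < a) ∧ (D' < 0 ∨ ENNReal.ofReal D' < b) ∧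
      s - 1 ≤ D + D' := by
  rcases eq_or_ne a ∞ with rfl | ha
  · exact ⟨s, -1, Or.inr ENNReal.ofReal_lt_top, Or.inl (by norm_num), by linarith⟩
  rcases eq_or_ne b ∞ with rfl | hb
  · exact ⟨-1, s, Or.inl (by norm_num), Or.inr ENNReal.ofReal_lt_top, by linarith⟩
  have hlt : ∀ c : ℝ≥0∞, c ≠ ∞ →
      (c.toReal - 1 / 2 < 0 ∨ ENNReal.ofReal (c.toReal - 1 / 2) < c) := by
    intro c hc
    rcases lt_or_ge (c.toReal - 1 / 2) 0 with h0 | h0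
    · exact Or.inl h0
    · exact Or.inr ((ENNReal.ofReal_lt_iff_lt_toReal h0 hc).2 (by linarith))
  refine ⟨_, _, hlt a ha, hlt b hb, ?_⟩
  rw [ENNReal.ofReal_le_iff_le_toReal (ENNReal.add_ne_top.2 ⟨ha, hb⟩),
    ENNReal.toReal_add ha hb] at h
  linarith

theorem ENNReal.ofReal_add_le_of_coe_le_sub {a : ℝ≥0∞} {x h : ℝ}
    (hle : (x : EReal) ≤ (a : EReal) - (h : EReal)) : ENNReal.ofReal (x + h) ≤ a := by
  rcases eq_or_ne a ∞ with rfl | ha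
  · exact le_top
  rw [← EReal.coe_ennreal_toReal ha, ← EReal.coe_sub, EReal.coe_le_coe_iff] at hle
  exact ENNReal.ofReal_le_of_le_toReal (by linarith)

end EmpiricalMeasure

/-! ### Assembly of the deviation bound -/

theorem proposition2 {Ω : Type*} {mΩ : MeasurableSpace Ω} (P : Measure Ω) [IsProbabilityMeasure P]
    {K : ℕ} (π ε B : ℝ) (hπ : π ∈ Ioo (0 : ℝ) 1) (hε : 0 < ε) (hB : 0 < B)
    (μ : Fin K → Measure ℝ) (hμ : ∀ a, μ a ∈ momentClass ε B)
    (ℱ : Filtration ℕ mΩ) (A : ℕ → Ω → Fin K) (X : ℕ → Ω → ℝ)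
    (hAX : IsBanditProcess μ P ℱ A X)
    (i j : Fin K) (hij : i ≠ j) (x : ℝ) (hx : 0 ≤ x) :
    P {ω | ∃ n : ℕ, (x : EReal) ≤
        (((pullCount A i n ω : ℝ≥0∞)
              * klInfU π ε B (empiricalMeasure A X i n ω) (condValueAtRisk π (μ i))
            + (pullCount A j n ω : ℝ≥0∞)
              * klInfL π ε B (empiricalMeasure A X j n ω) (condValueAtRisk π (μ j)) : ℝ≥0∞) : EReal)
          - ((5 * Real.log ((n : ℝ) + 1) + 2 : ℝ) : EReal)}
      ≤ ENNReal.ofReal (Real.exp (-x)) := by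
  set v := condValueAtRisk π (μ i) with hv
  set v' := condValueAtRisk π (μ j) with hv'
  set z := valueAtRisk π (μ j) with hz
  -- One joint parameter serves both arms, and other arms contribute the factor `1`, so a single
  -- supermartingale runs through all rounds whatever the sampling order.
  set S : Set ((ℝ × ℝ × ℝ) × (ℝ × ℝ)) := upperDualSet π ε B v ×ˢ lowerDualSet π ε B v' z with hS
  set G : Fin K → ℝ → (ℝ × ℝ × ℝ) × (ℝ × ℝ) → ℝ := fun a y l =>
    if a = i then upperDualFn π ε B v y l.1 else
      if a = j then lowerDualFn π ε B v' z y l.2 else 1 with hG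
  have hconv : Convex ℝ S := convex_upperDualSet.prod convex_lowerDualSet
  have hmain := hAX.measure_exists_prod_le (G := G) (S := S) (c := Real.exp x)
    (fun a => (hμ a).1) (by
      intro a
      simp only [hG]
      split_ifs
      · exact (continuous_uncurry_upperDualFn hε).measurable.comp
          (measurable_fst.prodMk measurable_snd.fst)
      · exact (continuous_uncurry_lowerDualFn hε).measurable.comp
          (measurable_fst.prodMk measurable_snd.snd)
      · exact measurable_const)
    hconv (by
      obtain ⟨l, hl, hl1⟩ := interior_upperDualSet_inter_ball_nonempty (v := v) hπ hε hB.le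
      obtain ⟨l', hl', hl1'⟩ :=
        interior_lowerDualSet_inter_ball_nonempty (ε := ε) (v := v') (z := z) hπ hB.le
      refine ⟨(l, l'), ?_, ?_⟩
      · rw [hS, interior_prod_eq]; exact ⟨hl, hl'⟩
      · rw [mem_ball_zero_iff] at *
        exact max_lt hl1 hl1')
    (by
      intro a y
      simp only [hG]
      split_ifs
      · exact ((concaveOn_upperDualFn y).comp_linearMap
          (LinearMap.fst ℝ (ℝ × ℝ × ℝ) (ℝ × ℝ))).subset (subset_univ _) hconv
      · exact ((concaveOn_lowerDualFn y).comp_linearMap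
          (LinearMap.snd ℝ (ℝ × ℝ × ℝ) (ℝ × ℝ))).subset (subset_univ _) hconv
      · exact concaveOn_const 1 hconv)
    (by
      intro a y l hl
      simp only [hG]
      split_ifs
      exacts [hl.1.2 y, hl.2.2 y, zero_le_one])
    (by
      intro a l hl
      have := (hμ a).1
      simp only [hG]
      split_ifs with h1 h2
      · subst h1; exact lintegral_upperDualFn_le hπ hε hB.le (hμ a) hl.1
      · subst h2; exact lintegral_lowerDualFn_le hπ hε hB.le (hμ a) hl.2
      · simp)
    (Real.exp_pos x)
  rw [← Real.exp_neg] at hmain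
  refine (measure_mono ?_).trans hmain
  rintro ω ⟨n, hn⟩
  obtain ⟨D, D', hD, hD', hle⟩ := ENNReal.exists_real_lt_of_ofReal_le_add
    (ENNReal.ofReal_add_le_of_coe_le_sub hn)
  obtain ⟨l, hl, hlD⟩ := exists_exp_le_prod (g := upperDualFn π ε B v)
    (S := upperDualSet π ε B v) (I := fun η => klInfU π ε B η v)
    (fun s w hw hw1 D hD hlt =>
      exists_upperDualFn_lt hπ hε hB.le (hμ i) hw hw1 Subtype.val_injective hD hlt)
    ⟨0, ⟨le_rfl, fun y => by simp [upperDualFn]⟩, fun y => by simp [upperDualFn]⟩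
    (pullTimes A i n ω) (fun t => X t ω) hD
  obtain ⟨l', hl', hlD'⟩ := exists_exp_le_prod (g := lowerDualFn π ε B v' z)
    (S := lowerDualSet π ε B v' z) (I := fun η => klInfL π ε B η v')
    (fun s w hw hw1 D hD hlt =>
      exists_lowerDualFn_lt hπ hε hB.le (hμ j) hw hw1 Subtype.val_injective hD hlt)
    ⟨0, ⟨le_rfl, fun y => by simp [lowerDualFn]⟩, fun y => by simp [lowerDualFn]⟩
    (pullTimes A j n ω) (fun t => X t ω) hD'
  refine ⟨n, (l, l'), ⟨hl, hl'⟩, ?_⟩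
  have hprod : ∏ t ∈ Finset.range n, G (A t ω) (X t ω) (l, l') =
      (∏ t ∈ pullTimes A i n ω, upperDualFn π ε B v (X t ω) l) *
        ∏ t ∈ pullTimes A j n ω, lowerDualFn π ε B v' z (X t ω) l' := by
    rw [pullTimes, pullTimes, Finset.prod_filter, Finset.prod_filter, ← Finset.prod_mul_distrib]
    refine Finset.prod_congr rfl fun t _ => ?_
    by_cases h1 : A t ω = i
    · simp [hG, h1, hij]
    · by_cases h2 : A t ω = j <;> simp [hG, h1, h2, hij.symm]
  have hfin : Module.finrank ℝ ((ℝ × ℝ × ℝ) × (ℝ × ℝ)) = 5 := by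
    simp [Module.finrank_prod]
  have hn0 : (0 : ℝ) < (n : ℝ) + 1 := by positivity
  rw [hprod, hfin]
  -- The `-1` combines the mixture factor `e` with the `2` in `h(n)`; what remains is exactly the
  -- slack left in `hle`.
  calc Real.exp x * (Real.exp 1 * ((n : ℝ) + 1) ^ 5)
      = Real.exp (x + (5 * Real.log ((n : ℝ) + 1) + 2) - 1) := by
        have h5 : ((n : ℝ) + 1) ^ 5 = Real.exp (5 * Real.log ((n : ℝ) + 1)) := by
          rw [← Real.exp_log hn0, ← Real.exp_nat_mul, Real.exp_log hn0]
          norm_num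
        rw [h5, ← Real.exp_add, ← Real.exp_add]
        congr 1
        ring
    _ ≤ Real.exp (D + D') := Real.exp_le_exp.2 hle
    _ = Real.exp D * Real.exp D' := Real.exp_add _ _
    _ ≤ _ := mul_le_mul hlD hlD' (Real.exp_pos _).le ((Real.exp_pos _).le.trans hlD)
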